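/- For a Dynkin diagram $D$ (of a finite-dimensional complex semisimple Lie algebra) and a connected nonempty subdiagram $I\subseteq D$, let $w_0^I$ be the longest element of the parabolic subgroup $W^I$ of the Weyl group, generated by the simple reflections $r_i$, $i\in I$, and let $\theta_I$ be the Dynkin diagram automorphism of $I$ with $\alpha_{\theta_I(i)}=-w_0^I\alpha_i$ for $i\in I$. The cactus group $J_D$ has generators $s_I$, one for each connected subdiagram $I$ of $D$, and relations (1) $s_I^2=1$; (2) $s_Is_J=s_Js_I$ if $I\cup J$ is disconnected; (3) $s_Is_J=s_{\theta_I(J)}s_I$ if $J\subseteq I$. Let $X\hookrightarrow Y$ be one of the following foldings, given by an automorphism $\mathrm{aut}$ of the diagram $Y$ and a bijection $\sigma\colon X\to Y/\mathrm{aut}$ under which $X$ is the folded diagram (nodes are numbered as by Bourbaki): * $X=C_n$, $Y=A_{2n-1}$ ($n\ge 2$), $\mathrm{aut}(i)=2n-i$, $\sigma(i)=\{i,2n-i\}$; * $X=B_n$, $Y=D_{n+1}$ ($n\ge 2$, where $D_3=A_3$ with node $1$ joined to nodes $2$ and $3$), $\mathrm{aut}$ exchanges $n$ and $n+1$, $\sigma(i)=\{i\}$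 for $i<n$ and $\sigma(n)=\{n,n+1\}$; * $X=G_2$, $Y=D_4$, $\mathrm{aut}$ rotates the nodes $1,3,4$, $\sigma(1)=\{1,3,4\}$ and $\sigma(2)=\{2\}$; * $X=F_4$, $Y=E_6$, $\mathrm{aut}$ is the nontrivial automorphism of $E_6$, $\sigma(1)=\{2\}$, $\sigma(2)=\{4\}$, $\sigma(3)=\{3,5\}$, $\sigma(4)=\{1,6\}$. For $I\subseteq X$ write $\sigma(I)\subseteq Y$ for the union of the orbits $\sigma(i)$, $i\in I$, and for $I$ connected put $$\tilde s_I=\prod_{\tilde I}s^Y_{\tilde I}\in J_Y,$$ the product over the connected components $\tilde I$ of $\sigma(I)$ of the (pairwise commuting) generators of $J_Y$. The virtual cactus group $J^v_X$ has generators $s_{\sigma(I)}$, one for each set $\sigma(I)$ with $I\subseteq X$ a connected subdiagram, and relations $s_{\sigma(I)}^2=1$; $s_{\sigma(I)}s_{\sigma(J)}=s_{\sigma(J)}s_{\sigma(I)}$ if $I\cup J$ is disconnected; $s_{\sigma(I)}s_{\sigma(J)}=s_{\sigma(\theta_I(J))}s_{\sigma(I)}$ if $J\subseteq I$. Then there is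 a group homomorphism $\Phi\colon J_X\to J_Y$ with $\Phi(s_I)=\tilde s_I$ for every connected subdiagram $I$ of $X$, and it is injective. Moreover there are group isomorphisms $J^v_X\cong\Phi(J_X)$, $s_{\sigma(I)}\mapsto\tilde s_I$, and $J^v_X\cong J_X$, $s_{\sigma(I)}\mapsto s_I$. -/

import Mathlib

/-!
Cartan matrices follow Mathlib's (Bourbaki's) convention `A i j = ⟨αᵢ, αⱼ^∨⟩`.  A Dynkin diagram
is given by its Cartan matrix; its nodes are the indices.
-/

noncomputable section

namespace Dynkin

variable {ι : Type*}

/-- The graph underlying the Dynkin diagram: distinct nodes `i`, `j` are joined iff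
`A i j ≠ 0` or `A j i ≠ 0`. -/
def graph (A : Matrix ι ι ℤ) : SimpleGraph ι :=
  SimpleGraph.fromRel fun i j => A i j ≠ 0

/-- `S` spans a connected (in particular nonempty) subdiagram. -/
def IsConn (A : Matrix ι ι ℤ) (S : Set ι) : Prop :=
  ((graph A).induce S).Connected

/-- The connected subdiagrams, ordered by inclusion of their sets of nodes. -/
abbrev ConnSub (A : Matrix ι ι ℤ) : Type _ :=
  {S : Set ι // IsConn A S}

section Weyl

variable [Fintype ι] [DecidableEq ι]

/-- The simple root `αᵢ`, as a vector of the root lattice `⨁ ℤ αⱼ`. -/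
def simpleRoot (i : ι) : ι → ℤ := Pi.single i 1

/-- The simple coroot `αᵢ^∨` as a functional on the root lattice: `αⱼ ↦ A j i`. -/
def simpleCoroot (A : Matrix ι ι ℤ) (i : ι) : (ι → ℤ) →ₗ[ℤ] ℤ :=
  LinearMap.proj i ∘ₗ A.vecMulLinear

/-- The simple reflection `v ↦ v - ⟨v, αᵢ^∨⟩ αᵢ`. -/
def simpleReflection (A : Matrix ι ι ℤ) (i : ι) : Module.End ℤ (ι → ℤ) :=
  LinearMap.id - (simpleCoroot A i).smulRight (simpleRoot i)

theorem simpleCoroot_simpleRoot (A : Matrix ι ι ℤ) (i j : ι) :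
    simpleCoroot A i (simpleRoot j) = A j i := by
  simp [simpleCoroot, simpleRoot]

theorem simpleReflection_simpleRoot (A : Matrix ι ι ℤ) (i j : ι) :
    simpleReflection A i (simpleRoot j) = simpleRoot j - A j i • simpleRoot i := by
  simp [simpleReflection, simpleCoroot_simpleRoot]

/-- Simple reflections are involutions, so that a monoid generated by some of them is a group. -/
theorem simpleReflection_mul_self (A : Matrix ι ι ℤ) (i : ι) (h : A i i = 2) :
    simpleReflection A i * simpleReflection A i = 1 := by
  refine LinearMap.ext fun v => ?_
  simp only [simpleReflection, Module.End.mul_apply, Module.End.one_apply, LinearMap.sub_apply,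
    LinearMap.id_apply, LinearMap.smulRight_apply, map_sub, map_smul, simpleCoroot_simpleRoot, h]
  ext k
  simp
  ring

/-- The parabolic subgroup `W^I` of the Weyl group, generated by the `rᵢ`, `i ∈ I`. -/
def parabolic (A : Matrix ι ι ℤ) (I : Set ι) : Submonoid (Module.End ℤ (ι → ℤ)) :=
  Submonoid.closure (simpleReflection A '' I)

/-- The length of an element of `W^I`: the least number of factors in an expression of it as a
product of simple reflections `rᵢ`, `i ∈ I`. -/
def weylLength (A : Matrix ι ι ℤ) (I : Set ι) (w : Module.End ℤ (ι → ℤ)) : ℕ :=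
  sInf {n | ∃ l : List ι, (∀ i ∈ l, i ∈ I) ∧ l.length = n ∧ (l.map (simpleReflection A)).prod = w}

/-- `w` is the longest element `w₀^I` of `W^I`. -/
def IsLongest (A : Matrix ι ι ℤ) (I : Set ι) (w : Module.End ℤ (ι → ℤ)) : Prop :=
  w ∈ parabolic A I ∧ ∀ v ∈ parabolic A I, weylLength A I v ≤ weylLength A I w

/-- `θ` is the Dynkin diagram automorphism `θ_I` of the subdiagram `I`, which is determined by
`α_{θ_I(i)} = - w₀^I αᵢ` for `i ∈ I`. -/
structure IsTheta (A : Matrix ι ι ℤ) (I : Set ι) (θ : Equiv.Perm I) : Prop where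
  cartan : ∀ i j : I, A (θ i) (θ j) = A i j
  longest : ∃ w, IsLongest A I w ∧
    ∀ i : I, simpleRoot (θ i : ι) = -w (simpleRoot (i : ι))

/-- `K = θ_I(J)`. -/
def IsThetaImage (A : Matrix ι ι ℤ) (I J K : Set ι) : Prop :=
  ∃ θ : Equiv.Perm I, IsTheta A I θ ∧ K = {k | ∃ i : I, (i : ι) ∈ J ∧ (θ i : ι) = k}

/-- The defining relations of the cactus group. -/
inductive CactusRel (A : Matrix ι ι ℤ) : FreeGroup (ConnSub A) → Prop
  | sq (I : ConnSub A) : CactusRel A (FreeGroup.of I * FreeGroup.of I)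
  | comm (I J : ConnSub A) (h : ¬ IsConn A (I.1 ∪ J.1)) :
      CactusRel A ((FreeGroup.of I * FreeGroup.of J) * (FreeGroup.of J * FreeGroup.of I)⁻¹)
  | conj (I J K : ConnSub A) (h : J.1 ⊆ I.1) (hK : IsThetaImage A I.1 J.1 K.1) :
      CactusRel A ((FreeGroup.of I * FreeGroup.of J) * (FreeGroup.of K * FreeGroup.of I)⁻¹)

/-- The cactus group of a Dynkin diagram. -/
abbrev CactusGroup (A : Matrix ι ι ℤ) : Type _ :=
  PresentedGroup {r | CactusRel A r}

/-- The generator `s_I` of the cactus group. -/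
def gen {A : Matrix ι ι ℤ} (I : ConnSub A) : CactusGroup A :=
  PresentedGroup.of I

theorem gen_comm {A : Matrix ι ι ℤ} (I J : ConnSub A) (h : ¬ IsConn A (I.1 ∪ J.1)) :
    Commute (gen I) (gen J) :=
  mul_inv_eq_one.mp (PresentedGroup.one_of_mem (CactusRel.comm I J h))

end Weyl

section Components

variable [Finite ι]

/-- The connected components of the subdiagram with set of nodes `S`: the maximal connected
subdiagrams contained in `S`. -/
def components (A : Matrix ι ι ℤ) (S : Set ι) : Finset (ConnSub A) :=
  (Set.toFinite {C : ConnSub A | Maximal (fun D : ConnSub A => D.1 ⊆ S) C}).toFinset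

theorem mem_components {A : Matrix ι ι ℤ} {S : Set ι} {C : ConnSub A} :
    C ∈ components A S ↔ Maximal (fun D : ConnSub A => D.1 ⊆ S) C := by
  simp [components]

theorem not_isConn_union {A : Matrix ι ι ℤ} {S : Set ι} {C D : ConnSub A}
    (hC : C ∈ components A S) (hD : D ∈ components A S) (hne : C ≠ D) :
    ¬ IsConn A (C.1 ∪ D.1) := by
  intro h
  rw [mem_components] at hC hD
  have hS : (⟨C.1 ∪ D.1, h⟩ : ConnSub A).1 ⊆ S := Set.union_subset hC.1 hD.1
  have h1 : C.1 ∪ D.1 ⊆ C.1 := hC.2 (y := ⟨C.1 ∪ D.1, h⟩) hS (Set.subset_union_left (t := D.1))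
  have h2 : C.1 ∪ D.1 ⊆ D.1 := hD.2 (y := ⟨C.1 ∪ D.1, h⟩) hS (Set.subset_union_right (s := C.1))
  exact hne (Subtype.ext (Set.Subset.antisymm (Set.subset_union_left.trans h2)
    (Set.subset_union_right.trans h1)))

end Components

/-- A folding `X ↪ Y`: an automorphism `aut` of the diagram of `Y` and a bijection `σ` of `X`
with the set `Y / aut` of `aut`-orbits which respects edges (with multiplicities and arrows): the
diagram of `X` is that of the subalgebra of `aut`-fixed points, whose simple roots are the
restrictions of the `α_y` and whose simple coroots are the sums of the `α_z^∨` over the orbits. -/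
structure Folding {X Y : Type*} [Fintype Y] (A : Matrix X X ℤ) (B : Matrix Y Y ℤ) where
  /-- the diagram automorphism of `Y` -/
  aut : Equiv.Perm Y
  aut_cartan : ∀ y z, B (aut y) (aut z) = B y z
  /-- the bijection with the set of orbits -/
  σ : X ≃ Quotient (Equiv.Perm.SameCycle.setoid aut)
  σ_cartan : ∀ (i j : X) (y : Y), σ i = Quotient.mk _ y →
    A i j = ∑ᶠ (z : Y) (_ : σ j = Quotient.mk _ z), B y z

namespace Folding

section Proj

variable {X Y : Type*} [DecidableEq X] [Fintype Y] {A : Matrix X X ℤ} {B : Matrix Y Y ℤ}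

/-- `σ(I)`, as a subset of `Y`: the union of the orbits `σ(i)`, `i ∈ I`. -/
def image (F : Folding A B) (I : Set X) : Set Y :=
  {y | ∃ i ∈ I, F.σ i = Quotient.mk _ y}

/-- The folding given by `aut` and by the map `π : Y → X` whose fibres are the orbits `σ(i)`. -/
def ofProj (aut : Equiv.Perm Y) (π : Y → X) (aut_cartan : ∀ y z, B (aut y) (aut z) = B y z)
    (hsurj : Function.Surjective π) (horb : ∀ y z, aut.SameCycle y z ↔ π y = π z)
    (hcartan : ∀ y j, A (π y) j = ∑ z with π z = j, B y z) : Folding A B where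
  aut := aut
  aut_cartan := aut_cartan
  σ := (Equiv.ofBijective
    (Quotient.lift (s := Equiv.Perm.SameCycle.setoid aut) π fun y z h => (horb y z).1 h)
    ⟨by
      intro a b
      induction a using Quotient.inductionOn
      induction b using Quotient.inductionOn
      exact fun h => Quotient.sound ((horb _ _).2 h),
    fun x => (hsurj x).elim fun y hy => ⟨Quotient.mk _ y, hy⟩⟩).symm
  σ_cartan := by
    intro i j y hy
    rw [Equiv.symm_apply_eq] at hy
    simp only [Equiv.symm_apply_eq]
    subst hy
    refine (hcartan y j).trans ?_
    rw [finsum_eq_sum_of_fintype, Finset.sum_filter]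
    refine Finset.sum_congr rfl fun z _ => ?_
    rw [finsum_eq_if]
    exact if_congr eq_comm rfl rfl

theorem mem_image_ofProj (aut : Equiv.Perm Y) (π : Y → X) (h1 : ∀ y z, B (aut y) (aut z) = B y z)
    (h2 : Function.Surjective π) (h3 : ∀ y z, aut.SameCycle y z ↔ π y = π z)
    (h4 : ∀ y j, A (π y) j = ∑ z with π z = j, B y z) (I : Set X) (y : Y) :
    y ∈ (ofProj aut π h1 h2 h3 h4).image I ↔ π y ∈ I := by
  constructor
  · rintro ⟨i, hi, h⟩
    have h' := (Equiv.symm_apply_eq _).1 h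
    rw [h'] at hi
    exact hi
  · exact fun h => ⟨π y, h, (Equiv.symm_apply_eq _).2 rfl⟩

end Proj

section General

variable {X Y : Type*} [Fintype X] [DecidableEq X] [Fintype Y] [DecidableEq Y]
  {A : Matrix X X ℤ} {B : Matrix Y Y ℤ}

/-- The product of the generators `s^Y_C` of the cactus group of `Y` over the connected components
`C` of `σ(I)`; these generators commute, so that their order does not matter. -/
def sTilde (F : Folding A B) (I : ConnSub A) : CactusGroup B :=
  (components B (F.image I.1)).noncommProd gen fun _ hC _ hD hne =>
    gen_comm _ _ (not_isConn_union hC hD hne)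

/-- The sets of nodes of `Y` of the form `σ(I)`, for `I` a connected subdiagram of `X`. -/
abbrev VirtualSub (F : Folding A B) : Type _ :=
  {S : Set Y // ∃ I : ConnSub A, F.image I.1 = S}

/-- The index `σ(I)` of a generator of the virtual cactus group. -/
def virtualSub (F : Folding A B) (I : ConnSub A) : F.VirtualSub :=
  ⟨F.image I.1, I, rfl⟩

/-- The defining relations of the virtual cactus group. -/
inductive VirtualRel (F : Folding A B) : FreeGroup F.VirtualSub → Prop
  | sq (I : ConnSub A) :
      VirtualRel F (FreeGroup.of (F.virtualSub I) * FreeGroup.of (F.virtualSub I))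
  | comm (I J : ConnSub A) (h : ¬ IsConn A (I.1 ∪ J.1)) :
      VirtualRel F ((FreeGroup.of (F.virtualSub I) * FreeGroup.of (F.virtualSub J)) *
        (FreeGroup.of (F.virtualSub J) * FreeGroup.of (F.virtualSub I))⁻¹)
  | conj (I J K : ConnSub A) (h : J.1 ⊆ I.1) (hK : IsThetaImage A I.1 J.1 K.1) :
      VirtualRel F ((FreeGroup.of (F.virtualSub I) * FreeGroup.of (F.virtualSub J)) *
        (FreeGroup.of (F.virtualSub K) * FreeGroup.of (F.virtualSub I))⁻¹)

/-- The virtual cactus group `J^v_X`. -/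
abbrev VirtualCactusGroup (F : Folding A B) : Type _ :=
  PresentedGroup {r | VirtualRel F r}

/-- The generator `s_{σ(I)}` of the virtual cactus group. -/
def virtualGen (F : Folding A B) (I : ConnSub A) : F.VirtualCactusGroup :=
  PresentedGroup.of (F.virtualSub I)

end General

/-! The foldings, with nodes numbered from `0`. -/

section Standard

theorem sameCycle_iff_of_involutive {α : Type*} (f : Equiv.Perm α) (hf : ∀ x, f (f x) = x)
    (x y : α) : f.SameCycle x y ↔ y = x ∨ y = f x := by
  have h2 : f * f = 1 := Equiv.ext hf
  constructor
  · rintro ⟨k, rfl⟩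
    obtain ⟨m, rfl | rfl⟩ := Int.even_or_odd' k
    · left
      rw [zpow_mul, zpow_two, h2, one_zpow, Equiv.Perm.one_apply]
    · right
      rw [zpow_add, zpow_mul, zpow_two, h2, one_zpow, one_mul, zpow_one]
  · rintro (rfl | rfl)
    · exact Equiv.Perm.SameCycle.refl f y
    · exact ⟨1, by simp⟩

/-- `C_n ⊂ A_{2n-1}`: `aut` is the reversal of the path, `σ(i) = {i, 2n-2-i}`. -/
def foldC (n : ℕ) (hn : 2 ≤ n) : Folding (CartanMatrix.C n) (CartanMatrix.A (2 * n - 1)) :=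
  ofProj Fin.revPerm (fun y => ⟨min y (2 * n - 2 - y), by omega⟩)
    (by
      intro y z
      simp only [CartanMatrix.A, Matrix.of_apply, Fin.revPerm_apply, Fin.ext_iff, Fin.val_rev]
      grind)
    (by
      intro x
      exact ⟨⟨x, by omega⟩, by ext; simp; omega⟩)
    (by
      intro y z
      rw [sameCycle_iff_of_involutive _ (by simp)]
      simp only [Fin.revPerm_apply, Fin.ext_iff, Fin.val_rev]
      omega)
    (by
      intro y j
      by_cases hj : (j : ℕ) = n - 1
      · have : (Finset.univ.filter fun z : Fin (2 * n - 1) =>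
            (⟨min z (2 * n - 2 - z), by omega⟩ : Fin n) = j) = {⟨n - 1, by omega⟩} := by
          ext z
          simp only [Finset.mem_filter, Finset.mem_univ, true_and, Finset.mem_singleton,
            Fin.ext_iff]
          omega
        rw [this, Finset.sum_singleton]
        simp only [CartanMatrix.A, CartanMatrix.C, Matrix.of_apply, Fin.ext_iff]
        split_ifs <;> omega
      · have : (Finset.univ.filter fun z : Fin (2 * n - 1) =>
            (⟨min z (2 * n - 2 - z), by omega⟩ : Fin n) = j) =
              {⟨j, by omega⟩, ⟨2 * n - 2 - j, by omega⟩} := by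
          ext z
          simp only [Finset.mem_filter, Finset.mem_univ, true_and, Finset.mem_singleton,
            Finset.mem_insert, Fin.ext_iff]
          omega
        rw [this, Finset.sum_pair (by simp only [ne_eq, Fin.ext_iff]; omega)]
        simp only [CartanMatrix.A, CartanMatrix.C, Matrix.of_apply, Fin.ext_iff]
        split_ifs <;> omega)

/-- The automorphism of `D_{n+1}` which exchanges the last two nodes. -/
def autD (n : ℕ) : Equiv.Perm (Fin (n + 1)) :=
  Equiv.swap ⟨n - 1, by omega⟩ ⟨n, by omega⟩

theorem autD_spec (n : ℕ) (hn : 2 ≤ n) (y : Fin (n + 1)) :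
    ((y : ℕ) = n - 1 ∧ (autD n y : ℕ) = n) ∨ ((y : ℕ) = n ∧ (autD n y : ℕ) = n - 1) ∨
      ((y : ℕ) < n - 1 ∧ (autD n y : ℕ) = y) := by
  simp only [autD, Equiv.swap_apply_def, Fin.ext_iff]
  split_ifs <;> simp <;> omega

theorem autD_cartan (n : ℕ) (hn : 2 ≤ n) (y z : Fin (n + 1)) :
    CartanMatrix.D (n + 1) (autD n y) (autD n z) = CartanMatrix.D (n + 1) y z := by
  have hy := autD_spec n hn y
  have hz := autD_spec n hn z
  generalize autD n y = a at *
  generalize autD n z = b at *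
  simp only [CartanMatrix.D, Matrix.of_apply, Fin.ext_iff]
  rw [if_congr (show (a : ℕ) = b ↔ (y : ℕ) = z by omega) rfl rfl]
  refine if_congr Iff.rfl rfl (if_congr Iff.rfl rfl ?_)
  refine if_congr (by omega) rfl (if_congr (by omega) rfl ?_)
  exact if_congr (by omega) rfl (if_congr (by omega) rfl rfl)

theorem autD_sameCycle (n : ℕ) (hn : 2 ≤ n) (y z : Fin (n + 1)) :
    (autD n).SameCycle y z ↔ min (y : ℕ) (n - 1) = min (z : ℕ) (n - 1) := by
  rw [sameCycle_iff_of_involutive _ (by simp [autD])]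
  have hy := autD_spec n hn y
  rw [Fin.ext_iff, Fin.ext_iff]
  omega

theorem D_apply_of_lt (n : ℕ) (y z : Fin (n + 1)) (hz : (z : ℕ) < n - 1) :
    CartanMatrix.D (n + 1) y z =
      if (y : ℕ) = z then 2 else if (y : ℕ) + 1 = z ∨ min (y : ℕ) (n - 1) = z + 1 then -1 else 0 := by
  have hy := y.isLt
  simp only [CartanMatrix.D, Matrix.of_apply, Fin.ext_iff]
  split_ifs <;> first | rfl | omega

theorem D_apply_of_le (n : ℕ) (hn : 2 ≤ n) (y z : Fin (n + 1)) (hz : n - 1 ≤ (z : ℕ)) :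
    CartanMatrix.D (n + 1) y z =
      if (y : ℕ) = z then 2 else if (y : ℕ) + 2 = n then -1 else 0 := by
  have hy := y.isLt
  have hz' := z.isLt
  simp only [CartanMatrix.D, Matrix.of_apply, Fin.ext_iff]
  split_ifs <;> first | rfl | omega

theorem foldB_cartan (n : ℕ) (hn : 2 ≤ n) (y : Fin (n + 1)) (j : Fin n) :
    CartanMatrix.B n ⟨min y (n - 1), by omega⟩ j =
      ∑ z ∈ Finset.univ.filter fun z : Fin (n + 1) => (⟨min z (n - 1), by omega⟩ : Fin n) = j,
        CartanMatrix.D (n + 1) y z := by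
  have hy := y.isLt
  have hj' := j.isLt
  by_cases hj : (j : ℕ) = n - 1
  · have : (Finset.univ.filter fun z : Fin (n + 1) =>
        (⟨min z (n - 1), by omega⟩ : Fin n) = j) = {⟨n - 1, by omega⟩, ⟨n, by omega⟩} := by
      ext z
      simp only [Finset.mem_filter, Finset.mem_univ, true_and, Finset.mem_singleton,
        Finset.mem_insert, Fin.ext_iff]
      omega
    rw [this, Finset.sum_pair (by simp only [ne_eq, Fin.ext_iff]; omega),
      D_apply_of_le n hn _ _ le_rfl, D_apply_of_le n hn _ _ (Nat.sub_le n 1)]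
    simp only [CartanMatrix.B, Matrix.of_apply, Fin.ext_iff]
    split_ifs <;> first | rfl | omega
  · have : (Finset.univ.filter fun z : Fin (n + 1) =>
        (⟨min z (n - 1), by omega⟩ : Fin n) = j) = {⟨j, by omega⟩} := by
      ext z
      simp only [Finset.mem_filter, Finset.mem_univ, true_and, Finset.mem_singleton,
        Fin.ext_iff]
      omega
    have hlt : (j : ℕ) < n - 1 := by omega
    rw [this, Finset.sum_singleton, D_apply_of_lt n _ _ hlt]
    simp only [CartanMatrix.B, Matrix.of_apply, Fin.ext_iff]
    split_ifs <;> first | rfl | omega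

/-- `B_n ⊂ D_{n+1}`: `aut` exchanges the last two nodes, `σ(n-1) = {n-1, n}` and `σ(i) = {i}`
for `i < n-1`. -/
def foldB (n : ℕ) (hn : 2 ≤ n) : Folding (CartanMatrix.B n) (CartanMatrix.D (n + 1)) :=
  ofProj (autD n) (fun y => ⟨min y (n - 1), by omega⟩) (autD_cartan n hn)
    (fun x => ⟨⟨x, by omega⟩, by ext; simp; omega⟩)
    (fun y z => by rw [autD_sameCycle n hn, Fin.mk.injEq])
    (foldB_cartan n hn)

/-- The automorphism of `D_4` which rotates the three legs. -/
def triality : Equiv.Perm (Fin 4) :=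
  Equiv.swap 0 2 * Equiv.swap 2 3

/-- The nontrivial automorphism of `E_6`. -/
def autE : Equiv.Perm (Fin 6) :=
  Equiv.swap 0 5 * Equiv.swap 2 4

theorem triality_cartan :
    (CartanMatrix.D 4).submatrix triality triality = CartanMatrix.D 4 := by
  decide

theorem autE_cartan : CartanMatrix.E₆.submatrix autE autE = CartanMatrix.E₆ := by
  decide

/-- `G_2 ⊂ D_4`: `aut` rotates the three legs, `σ(0) = {0, 2, 3}` and `σ(1) = {1}`; the
node `0` of `G_2` is the short simple root, whence the transpose of Mathlib's matrix. -/
def foldG : Folding (CartanMatrix.G₂.transpose) (CartanMatrix.D 4) :=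
  ofProj triality ![0, 1, 0, 0]
    (fun y z => congrFun (congrFun triality_cartan y) z)
    (by decide) (by decide) (by decide)

/-- `F_4 ⊂ E_6`: `aut` is the nontrivial automorphism of `E_6`, and `σ(0) = {1}`, `σ(1) = {3}`,
`σ(2) = {2, 4}`, `σ(3) = {0, 5}`. -/
def foldF : Folding CartanMatrix.F₄ CartanMatrix.E₆ :=
  ofProj autE ![3, 0, 2, 1, 2, 3]
    (fun y z => congrFun (congrFun autE_cartan y) z)
    (by decide)
    (fun y z => by rw [sameCycle_iff_of_involutive _ (by decide)]; revert y z; decide)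
    (by decide)

/-- The list of foldings of a twisted diagram `X` into a simply laced diagram `Y`. -/
inductive IsStandard : ∀ {m k : ℕ} {A : Matrix (Fin m) (Fin m) ℤ} {B : Matrix (Fin k) (Fin k) ℤ},
    Folding A B → Prop
  | C (n : ℕ) (hn : 2 ≤ n) : IsStandard (foldC n hn)
  | B (n : ℕ) (hn : 2 ≤ n) : IsStandard (foldB n hn)
  | G : IsStandard foldG
  | F : IsStandard foldF

end Standard

end Folding

end Dynkin

end

/-! Everything follows from two properties of `B` and `A`: `B` is symmetric, positive definite, with
diagonal `2` and nonpositive off-diagonal entries, and `A` has diagonal `2`. The vectors of norm `2`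
then form a root system for `Y`, and their images under the folding of root lattices form one for
`X`. The usual theory of inversions gives longest elements, characterised as the elements of `W^I`
which negate the simple roots of `I`.

The homomorphism exists because a simple reflection of `X` lifts to the product of the commuting
reflections in an orbit. Hence folding carries the longest element of `σ(I)` to that of `I`
(`foldMap_longest`), so `θ_{σ(I)}(σ(J)) = σ(θ_I(J))` (`opp_image`). The relations of `J_X` thus
become relations between products over components (`setGen_comm`, `setGen_mul_setGen`).

For injectivity, `J_Y` is made to act on the elements of a right-angled Coxeter group. The letters
are sets of vectors of the root lattice, two of them commuting if they are nested or orthogonal, and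
Weyl group elements permute the letters. The generator `s_I` acts as `w₀^I` followed by
multiplication by the letter spanned by `I`. The relation `s_I s_J = s_{θ_I(J)} s_I` holds because
`w₀^I` maps the span of `J` to that of `θ_I(J)`, and nested letters commute.

Given `g` in `J_X`, choose a shortest word for it and apply `Φ(g)` to the empty word. Each `s_K`
contributes the spans of the components of `σ(K)`, moved by longest elements. If a component of
`σ(I)` cancelled against a later letter, then, since every component of `σ(K)` projects onto all of
`K` (`proj_image_component`), the same moves could be made in `J_X`, carrying `s_I` to an equal
generator and shortening the word (`exists_shorter`). So the word obtained is reduced, and it is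
empty only if the word for `g` is.

The virtual cactus group is the presentation of `J_X` with generators renamed along the injective
map `I ↦ σ(I)`. -/

noncomputable section

set_option linter.unusedSectionVars false

namespace Dynkin

/-! ### Reduced words in partially commuting involutions -/

section Words

open scoped Classical

variable {V : Type*} {c : V → V → Prop}

/-- Some letter `p` of the word can be moved to its front past letters commuting with `p`. -/
def Cancels (c : V → V → Prop) (p : V) : List V → Prop
  | [] => False
  | x :: w => x = p ∨ (c p x ∧ Cancels c p w)

/-- No letter of the word cancels against a later one. -/
def Reduced (c : V → V → Prop) : List V → Prop
  | [] => True
  | x :: w => ¬ Cancels c x w ∧ Reduced c w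

/-- Equality of words up to exchanging commuting neighbours, expressed by the projections to pairs
of letters which do not commute. -/
def TraceEquiv (c : V → V → Prop) (w w' : List V) : Prop :=
  ∀ a b, (a = b ∨ ¬ c a b) →
    w.filter (fun x => x = a ∨ x = b) = w'.filter (fun x => x = a ∨ x = b)

theorem TraceEquiv.cons_iff {p : V} {w w' : List V} :
    TraceEquiv c (p :: w) (p :: w') ↔ TraceEquiv c w w' := by
  refine forall_congr' fun a => forall_congr' fun b => imp_congr_right fun _ => ?_
  by_cases h : p = a ∨ p = b <;> simp [h]

/-- A projection sees the exchange only if it keeps both `p` and `q`, and `TraceEquiv` does not test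
pairs of distinct commuting letters. -/
theorem TraceEquiv.swap (hs : ∀ ⦃p q⦄, c p q → c q p) {p q : V} (h : c p q) (w : List V) :
    TraceEquiv c (p :: q :: w) (q :: p :: w) := by
  intro a b hab
  by_cases hpq : p = q
  · rw [hpq]
  by_cases hp : p = a ∨ p = b <;> by_cases hq : q = a ∨ q = b <;>
    simp only [List.filter_cons, hp, hq, decide_true, decide_false, if_true, if_false,
      Bool.false_eq_true]
  exfalso
  rcases hp with rfl | rfl <;> rcases hq with rfl | rfl
  · exact hpq rfl
  · exact hab.elim hpq fun h' => h' h
  · exact hab.elim (fun e => hpq e.symm) fun h' => h' (hs h)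
  · exact hpq rfl

theorem TraceEquiv.refl (w : List V) : TraceEquiv c w w := fun _ _ _ => rfl

theorem TraceEquiv.symm {w w' : List V} (h : TraceEquiv c w w') : TraceEquiv c w' w :=
  fun a b hab => (h a b hab).symm

theorem TraceEquiv.trans {u v w : List V} (h : TraceEquiv c u v) (h' : TraceEquiv c v w) :
    TraceEquiv c u w :=
  fun a b hab => (h a b hab).trans (h' a b hab)

theorem TraceEquiv.eq_nil {w : List V} (h : TraceEquiv c w []) : w = [] := by
  rcases w with _ | ⟨x, w⟩
  · rfl
  · simpa using h x x (Or.inl rfl)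

/-- Expresses cancellation by the projections alone, which makes it invariant under `TraceEquiv`. A
letter `x` blocking the way of `p` is detected by the projection to `p` and `x`, which then begins
with `x`. -/
theorem cancels_iff_head {p : V} (w : List V) :
    Cancels c p w ↔ ∀ b, (p = b ∨ ¬ c p b) →
      (w.filter (fun x => x = p ∨ x = b)).head? = some p := by
  induction w with
  | nil => exact ⟨False.elim, fun h => by simpa using h p (Or.inl rfl)⟩
  | cons x w ih =>
    rw [Cancels]
    by_cases hx : x = p
    · simp [hx]
    by_cases hc : c p x
    · simp only [hx, hc, true_and, false_or, ih]
      refine forall_congr' fun b => imp_congr_right fun hb => ?_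
      have : x ≠ b := by
        rintro rfl
        exact hb.elim (fun e => hx e.symm) fun h => h hc
      simp [this, hx]
    · simp only [hx, hc, false_and, or_self, false_iff, not_forall]
      exact ⟨x, Or.inr hc, by simp [hx]⟩

theorem Cancels.congr {p : V} {w w' : List V} (h : TraceEquiv c w w') :
    Cancels c p w ↔ Cancels c p w' := by
  rw [cancels_iff_head, cancels_iff_head]
  refine forall_congr' fun b => imp_congr_right fun hb => ?_
  rw [h p b hb]

theorem Cancels.equiv_cons_erase (hs : ∀ ⦃p q⦄, c p q → c q p) {p : V} {w : List V} (h : Cancels c p w) :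
    TraceEquiv c (p :: w.erase p) w := by
  induction w with
  | nil => exact h.elim
  | cons x w ih =>
    by_cases hx : x = p
    · simp only [hx, List.erase_cons_head]
      exact TraceEquiv.refl _
    · obtain ⟨h1, h2⟩ := h.resolve_left hx
      rw [List.erase_cons_tail (by simpa using hx)]
      exact (TraceEquiv.swap hs h1 _).trans (TraceEquiv.cons_iff.2 (ih h2))

theorem Cancels.cons_iff {p x : V} (hx : x ≠ p) (h : c p x) (w : List V) :
    Cancels c p (x :: w) ↔ Cancels c p w := by
  simp [Cancels, hx, h]

theorem Cancels.erase_iff (hs : ∀ ⦃p q⦄, c p q → c q p) {p q : V} (hne : p ≠ q) (hc : c p q) {w : List V}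
    (h : Cancels c p w) : Cancels c q (w.erase p) ↔ Cancels c q w := by
  rw [← Cancels.congr (h.equiv_cons_erase hs), Cancels.cons_iff hne (hs hc)]

/-- A second `p` that could still reach the front would cancel against the first one inside `w`. -/
theorem Reduced.not_cancels_erase {p : V} {w : List V} (hw : Reduced c w) (h : Cancels c p w) :
    ¬ Cancels c p (w.erase p) := by
  induction w with
  | nil => exact h.elim
  | cons x w ih =>
    by_cases hx : x = p
    · subst hx
      simpa using hw.1
    · obtain ⟨h1, h2⟩ := h.resolve_left hx
      rw [List.erase_cons_tail (by simpa using hx), Cancels.cons_iff hx h1]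
      exact ih hw.2 h2

theorem Reduced.erase (hs : ∀ ⦃p q⦄, c p q → c q p) {p : V} {w : List V} (hw : Reduced c w)
    (h : Cancels c p w) : Reduced c (w.erase p) := by
  induction w with
  | nil => exact h.elim
  | cons x w ih =>
    by_cases hx : x = p
    · subst hx
      simpa using hw.2
    · obtain ⟨h1, h2⟩ := h.resolve_left hx
      rw [List.erase_cons_tail (by simpa using hx)]
      refine ⟨?_, ih hw.2 h2⟩
      rw [Cancels.erase_iff hs (Ne.symm hx) h1 h2]
      exact hw.1

/-- Multiplication of a reduced word by a letter. -/
def wordAct (c : V → V → Prop) (p : V) (w : List V) : List V :=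
  if Cancels c p w then w.erase p else p :: w

theorem wordAct_of_cancels {p : V} {w : List V} (h : Cancels c p w) :
    wordAct c p w = w.erase p := if_pos h

theorem wordAct_of_not_cancels {p : V} {w : List V} (h : ¬ Cancels c p w) :
    wordAct c p w = p :: w := if_neg h

theorem Reduced.wordAct (hs : ∀ ⦃p q⦄, c p q → c q p) (p : V) {w : List V} (hw : Reduced c w) :
    Reduced c (wordAct c p w) := by
  by_cases h : Cancels c p w
  · rw [wordAct_of_cancels h]
    exact hw.erase hs h
  · rw [wordAct_of_not_cancels h]
    exact ⟨h, hw⟩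

theorem TraceEquiv.wordAct (hs : ∀ ⦃p q⦄, c p q → c q p) (p : V) {w w' : List V} (h : TraceEquiv c w w') :
    TraceEquiv c (wordAct c p w) (wordAct c p w') := by
  by_cases hp : Cancels c p w
  · have hp' := (Cancels.congr h).1 hp
    rw [wordAct_of_cancels hp, wordAct_of_cancels hp', ← TraceEquiv.cons_iff (p := p)]
    exact (hp.equiv_cons_erase hs).trans (h.trans (hp'.equiv_cons_erase hs).symm)
  · rw [wordAct_of_not_cancels hp, wordAct_of_not_cancels (mt (Cancels.congr h).2 hp)]
    exact TraceEquiv.cons_iff.2 h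

theorem wordAct_wordAct_self (hs : ∀ ⦃p q⦄, c p q → c q p) (p : V) {w : List V} (hw : Reduced c w) :
    TraceEquiv c (wordAct c p (wordAct c p w)) w := by
  by_cases h : Cancels c p w
  · rw [wordAct_of_cancels h, wordAct_of_not_cancels (hw.not_cancels_erase h)]
    exact h.equiv_cons_erase hs
  · rw [wordAct_of_not_cancels h, wordAct_of_cancels (by simp [Cancels]), List.erase_cons_head]
    exact TraceEquiv.refl w

theorem cancels_wordAct_iff (hs : ∀ ⦃p q⦄, c p q → c q p) {p q : V} (hne : p ≠ q) (hc : c p q) (w : List V) :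
    Cancels c q (wordAct c p w) ↔ Cancels c q w := by
  by_cases h : Cancels c p w
  · rw [wordAct_of_cancels h, h.erase_iff hs hne hc]
  · rw [wordAct_of_not_cancels h, Cancels.cons_iff hne (hs hc)]

/-- Distinct commuting letters do not influence each other's cancellation, so both orders erase or
prepend the same letters. The results differ at most by a swap, when neither letter cancels. -/
theorem wordAct_comm (hs : ∀ ⦃p q⦄, c p q → c q p) {p q : V} (hc : c p q) (w : List V) :
    TraceEquiv c (wordAct c p (wordAct c q w)) (wordAct c q (wordAct c p w)) := by
  by_cases hne : p = q
  · rw [hne]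
    exact TraceEquiv.refl _
  have h1 := cancels_wordAct_iff hs hne hc w
  have h2 := cancels_wordAct_iff hs (Ne.symm hne) (hs hc) w
  have hne' : q ≠ p := Ne.symm hne
  by_cases hp : Cancels c p w <;> by_cases hq : Cancels c q w
  · rw [wordAct_of_cancels (h2.2 hp), wordAct_of_cancels (h1.2 hq), wordAct_of_cancels hp,
      wordAct_of_cancels hq, List.erase_comm]
    exact TraceEquiv.refl _
  · rw [wordAct_of_cancels (h2.2 hp), wordAct_of_not_cancels (mt h1.1 hq), wordAct_of_cancels hp,
      wordAct_of_not_cancels hq, List.erase_cons_tail (by simpa using hne')]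
    exact TraceEquiv.refl _
  · rw [wordAct_of_not_cancels (mt h2.1 hp), wordAct_of_cancels (h1.2 hq),
      wordAct_of_not_cancels hp, wordAct_of_cancels hq, List.erase_cons_tail (by simpa using hne)]
    exact TraceEquiv.refl _
  · rw [wordAct_of_not_cancels (mt h2.1 hp), wordAct_of_not_cancels (mt h1.1 hq),
      wordAct_of_not_cancels hp, wordAct_of_not_cancels hq]
    exact TraceEquiv.swap hs hc w

theorem cancels_map_iff (f : Equiv.Perm V) (hf : ∀ p q, c (f p) (f q) ↔ c p q) 
    (p : V) (w : List V) :
    Cancels c (f p) (w.map f) ↔ Cancels c p w := by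
  induction w with
  | nil => exact Iff.rfl
  | cons x w ih => simp [Cancels, hf, ih]

theorem reduced_map_iff (f : Equiv.Perm V) (hf : ∀ p q, c (f p) (f q) ↔ c p q) 
    (w : List V) : Reduced c (w.map f) ↔ Reduced c w := by
  induction w with
  | nil => exact Iff.rfl
  | cons x w ih => simp [Reduced, cancels_map_iff f hf, ih]

theorem TraceEquiv.map (f : Equiv.Perm V) (hf : ∀ p q, c (f p) (f q) ↔ c p q) 
    {w w' : List V} (h : TraceEquiv c w w') :
    TraceEquiv c (w.map f) (w'.map f) := by
  intro a b hab
  have := h (f.symm a) (f.symm b) (by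
    rwa [← hf, f.apply_symm_apply, f.apply_symm_apply, f.symm.injective.eq_iff])
  have key : ((fun x => decide (x = a ∨ x = b)) ∘ f) =
      fun x => decide (x = f.symm a ∨ x = f.symm b) := by
    ext x
    simp [Equiv.eq_symm_apply]
  rw [List.filter_map, List.filter_map, key, this]

theorem map_wordAct (f : Equiv.Perm V) (hf : ∀ p q, c (f p) (f q) ↔ c p q) 
    (p : V) (w : List V) :
    (wordAct c p w).map f = wordAct c (f p) (w.map f) := by
  by_cases h : Cancels c p w
  · rw [wordAct_of_cancels h, wordAct_of_cancels ((cancels_map_iff f hf p w).2 h),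
      List.map_erase f.injective]
  · rw [wordAct_of_not_cancels h, wordAct_of_not_cancels (mt (cancels_map_iff f hf p w).1 h),
      List.map_cons]

/-- Reduced words up to exchanging commuting neighbours. -/
def traceSetoid (c : V → V → Prop) : Setoid {w : List V // Reduced c w} where
  r w w' := TraceEquiv c w.1 w'.1
  iseqv := ⟨fun w => TraceEquiv.refl w.1, TraceEquiv.symm, TraceEquiv.trans⟩

/-- The elements of the right-angled Coxeter group with commutation relation `c`. -/
abbrev Trace (c : V → V → Prop) : Type _ := Quotient (traceSetoid c)

/-- The class of a reduced word. -/
def Trace.mk (w : List V) (hw : Reduced c w) : Trace c := Quotient.mk (traceSetoid c) ⟨w, hw⟩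

theorem Trace.mk_eq_mk {w w' : List V} {hw : Reduced c w} {hw' : Reduced c w'} :
    Trace.mk w hw = Trace.mk w' hw' ↔ TraceEquiv c w w' :=
  Quotient.eq (r := traceSetoid c)

/-- Multiplication by a letter, as a function. -/
def Trace.act (hs : ∀ ⦃p q⦄, c p q → c q p) (p : V) : Trace c → Trace c :=
  Quotient.map' (fun w => ⟨wordAct c p w.1, w.2.wordAct hs p⟩) fun _ _ h => h.wordAct hs p

theorem Trace.act_involutive (hs : ∀ ⦃p q⦄, c p q → c q p) (p : V) :
    Function.Involutive (Trace.act hs p) := by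
  rintro ⟨w, hw⟩
  exact Trace.mk_eq_mk.2 (wordAct_wordAct_self hs p hw)

/-- Multiplication by a letter, as a permutation. -/
def Trace.actPerm (hs : ∀ ⦃p q⦄, c p q → c q p) (p : V) : Equiv.Perm (Trace c) :=
  (Trace.act_involutive hs p).toPerm

theorem Trace.actPerm_mul_self (hs : ∀ ⦃p q⦄, c p q → c q p) (p : V) :
    Trace.actPerm hs p * Trace.actPerm hs p = 1 :=
  Equiv.ext (Trace.act_involutive hs p)

theorem Trace.actPerm_comm (hs : ∀ ⦃p q⦄, c p q → c q p) {p q : V} (h : c p q) :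
    Commute (Trace.actPerm hs p) (Trace.actPerm hs q) := by
  refine Equiv.ext ?_
  rintro ⟨w, hw⟩
  exact Trace.mk_eq_mk.2 (wordAct_comm hs h w)

/-- The permutations of the letters which respect the commutation relation. -/
def commPerms (c : V → V → Prop) : Subgroup (Equiv.Perm V) where
  carrier := {f | ∀ p q, c (f p) (f q) ↔ c p q}
  one_mem' := fun _ _ => Iff.rfl
  mul_mem' := fun {f g} hf hg p q => (hf _ _).trans (hg p q)
  inv_mem' := fun {f} hf p q => by
    rw [← hf, ← Equiv.Perm.mul_apply, ← Equiv.Perm.mul_apply, mul_inv_cancel,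
      Equiv.Perm.one_apply, Equiv.Perm.one_apply]

/-- The action of permutations of the letters on classes of reduced words. -/
def Trace.mapPerm (c : V → V → Prop) : commPerms c →* Equiv.Perm (Trace c) :=
  MonoidHom.toHomPerm
    { toFun := fun f => Quotient.map' (fun w => ⟨w.1.map f.1, (reduced_map_iff f.1 f.2 w.1).2 w.2⟩)
        fun _ _ h => h.map f.1 f.2
      map_one' := by
        funext t
        obtain ⟨w, hw⟩ := t
        exact Trace.mk_eq_mk.2 (by
          simp only [OneMemClass.coe_one, Equiv.Perm.coe_one, List.map_id]
          exact TraceEquiv.refl w)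
      map_mul' := fun f g => by
        funext t
        obtain ⟨w, hw⟩ := t
        exact Trace.mk_eq_mk.2 (by
          simp only [Subgroup.coe_mul, Equiv.Perm.coe_mul, ← List.map_map]
          exact TraceEquiv.refl _) }

theorem Trace.mapPerm_mk (f : commPerms c) {w : List V} (hw : Reduced c w) :
    Trace.mapPerm c f (Trace.mk w hw) =
      Trace.mk (w.map f.1) ((reduced_map_iff f.1 f.2 w).2 hw) := rfl

/-- The commutation rule of a semidirect product: letters and permutations of letters act together.
-/
theorem Trace.mapPerm_mul_actPerm (hs : ∀ ⦃p q⦄, c p q → c q p) (f : commPerms c) (p : V) :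
    Trace.mapPerm c f * Trace.actPerm hs p = Trace.actPerm hs (f.1 p) * Trace.mapPerm c f := by
  refine Equiv.ext ?_
  rintro ⟨w, hw⟩
  refine Trace.mk_eq_mk.2 ?_
  rw [map_wordAct f.1 f.2]
  exact TraceEquiv.refl _

end Words

/-! ### Weyl groups acting on a finite set of roots -/

section Roots

variable {ι : Type*} [Fintype ι] [DecidableEq ι]

theorem simpleCoroot_apply (A : Matrix ι ι ℤ) (i : ι) (v : ι → ℤ) :
    simpleCoroot A i v = ∑ k, v k * A k i := rfl

theorem simpleReflection_apply (A : Matrix ι ι ℤ) (i : ι) (v : ι → ℤ) :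
    simpleReflection A i v = v - simpleCoroot A i v • simpleRoot i := rfl

theorem simpleReflection_apply_of_ne (A : Matrix ι ι ℤ) {i k : ι} (h : k ≠ i) (v : ι → ℤ) :
    simpleReflection A i v k = v k := by
  simp [simpleReflection_apply, simpleRoot, h]

theorem sum_smul_simpleRoot (v : ι → ℤ) : ∑ i, v i • simpleRoot i = v := by
  ext k
  simp [simpleRoot, Finset.sum_apply, Pi.single_apply]

theorem simpleRoot_injective : Function.Injective (simpleRoot : ι → ι → ℤ) := by
  intro i j h
  by_contra hne
  have := congrFun h i
  simp [simpleRoot, hne] at this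

theorem simpleRoot_nonneg (i : ι) : 0 ≤ (simpleRoot i : ι → ℤ) :=
  Pi.single_nonneg.2 zero_le_one

theorem simpleRoot_ne_zero (i : ι) : (simpleRoot i : ι → ℤ) ≠ 0 := by
  simp [simpleRoot]

theorem not_simpleRoot_nonpos (i : ι) : ¬ (simpleRoot i : ι → ℤ) ≤ 0 := fun h =>
  simpleRoot_ne_zero i (le_antisymm h (simpleRoot_nonneg i))

/-- The bilinear form `(αᵢ, αⱼ) = A i j * d j`. -/
def form (A : Matrix ι ι ℤ) (d : ι → ℤ) : (ι → ℤ) →ₗ[ℤ] (ι → ℤ) →ₗ[ℤ] ℤ :=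
  ∑ j, d j • (LinearMap.mul ℤ ℤ).compl₁₂ (simpleCoroot A j) (LinearMap.proj j)

theorem form_apply (A : Matrix ι ι ℤ) (d : ι → ℤ) (u v : ι → ℤ) :
    form A d u v = ∑ j, d j * (simpleCoroot A j u * v j) := by
  simp [form, LinearMap.sum_apply]

theorem form_simpleRoot_right (A : Matrix ι ι ℤ) (d : ι → ℤ) (u : ι → ℤ) (i : ι) :
    form A d u (simpleRoot i) = d i * simpleCoroot A i u := by
  simp [form_apply, simpleRoot, Pi.single_apply]

/-- `d` symmetrizes the matrix `A`, whose diagonal entries are `2`. -/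
structure IsSymmetrizable (A : Matrix ι ι ℤ) (d : ι → ℤ) : Prop where
  diag : ∀ i, A i i = 2
  pos : ∀ i, 0 < d i
  symm : ∀ i j, A i j * d j = A j i * d i

/-- `Φ` is a finite reduced set of roots for the Weyl group of `A`, and `d` symmetrizes `A`. -/
structure IsRootDatum (A : Matrix ι ι ℤ) (d : ι → ℤ) (Φ : Set (ι → ℤ)) : Prop
    extends IsSymmetrizable A d where
  finite : Φ.Finite
  simple : ∀ i, simpleRoot i ∈ Φ
  refl : ∀ i, ∀ v ∈ Φ, simpleReflection A i v ∈ Φ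
  ne_zero : ∀ v ∈ Φ, v ≠ 0
  sign : ∀ v ∈ Φ, 0 ≤ v ∨ v ≤ 0
  reduced : ∀ v ∈ Φ, ∀ i, (∀ j, j ≠ i → v j = 0) → v i ≤ 1

theorem mem_parabolic_iff {A : Matrix ι ι ℤ} {I : Set ι} {w : Module.End ℤ (ι → ℤ)} :
    w ∈ parabolic A I ↔
      ∃ l : List ι, (∀ i ∈ l, i ∈ I) ∧ (l.map (simpleReflection A)).prod = w := by
  constructor
  · intro h
    induction h using Submonoid.closure_induction_left with
    | one => exact ⟨[], by simp, by simp⟩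
    | mul_left x hx y _ ih =>
      obtain ⟨i, hi, rfl⟩ := hx
      obtain ⟨l, hl, rfl⟩ := ih
      exact ⟨i :: l, by simpa using ⟨hi, hl⟩, by simp⟩
  · rintro ⟨l, hl, rfl⟩
    refine Submonoid.list_prod_mem _ fun x hx => ?_
    obtain ⟨i, hi, rfl⟩ := List.mem_map.1 hx
    exact Submonoid.subset_closure ⟨i, hl i hi, rfl⟩

theorem simpleReflection_mem_parabolic (A : Matrix ι ι ℤ) {I : Set ι} {i : ι} (hi : i ∈ I) :
    simpleReflection A i ∈ parabolic A I :=
  Submonoid.subset_closure ⟨i, hi, rfl⟩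

theorem parabolic_mono (A : Matrix ι ι ℤ) {I J : Set ι} (h : I ⊆ J) :
    parabolic A I ≤ parabolic A J :=
  Submonoid.closure_mono (Set.image_mono h)

theorem apply_of_notMem {A : Matrix ι ι ℤ} {I : Set ι} {w : Module.End ℤ (ι → ℤ)}
    (hw : w ∈ parabolic A I) (v : ι → ℤ) {k : ι} (hk : k ∉ I) : w v k = v k := by
  induction hw using Submonoid.closure_induction_left with
  | one => rfl
  | mul_left x hx y _ ih =>
    obtain ⟨i, hi, rfl⟩ := hx
    rw [Module.End.mul_apply, simpleReflection_apply_of_ne A (fun h => hk (by rwa [h])), ih]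

/-- `w` is the element of `W^I` which maps the simple roots `αᵢ`, `i ∈ I`, to negative vectors. -/
def NegatesSimple (A : Matrix ι ι ℤ) (I : Set ι) (w : Module.End ℤ (ι → ℤ)) : Prop :=
  w ∈ parabolic A I ∧ ∀ i ∈ I, w (simpleRoot i) ≤ 0

theorem NegatesSimple.apply_nonpos {A : Matrix ι ι ℤ} {I : Set ι} {w : Module.End ℤ (ι → ℤ)}
    (hw : NegatesSimple A I w) {v : ι → ℤ} (h0 : 0 ≤ v) (hv : ∀ i, i ∉ I → v i = 0) :
    w v ≤ 0 := by
  rw [← sum_smul_simpleRoot v, map_sum]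
  refine Finset.sum_nonpos fun i _ => ?_
  rw [map_smul]
  by_cases hi : i ∈ I
  · exact smul_nonpos_of_nonneg_of_nonpos (h0 i) (hw.2 i hi)
  · simp [hv i hi]

/-- The positive roots which `w` maps to negative ones. -/
def inversions (Φ : Set (ι → ℤ)) (w : Module.End ℤ (ι → ℤ)) : Set (ι → ℤ) :=
  {v | v ∈ Φ ∧ 0 ≤ v ∧ w v ≤ 0}

namespace IsSymmetrizable

variable {A : Matrix ι ι ℤ} {d : ι → ℤ}

theorem form_comm (h : IsSymmetrizable A d) (u v : ι → ℤ) : form A d u v = form A d v u := by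
  simp only [form_apply, simpleCoroot_apply, Finset.sum_mul, Finset.mul_sum]
  rw [Finset.sum_comm]
  refine Finset.sum_congr rfl fun i _ => Finset.sum_congr rfl fun j _ => ?_
  linear_combination u i * v j * h.symm i j

theorem form_simpleRoot_left (h : IsSymmetrizable A d) (u : ι → ℤ) (i : ι) :
    form A d (simpleRoot i) u = d i * simpleCoroot A i u := by
  rw [h.form_comm, form_simpleRoot_right]

theorem form_simpleReflection (h : IsSymmetrizable A d) (i : ι) (u v : ι → ℤ) :
    form A d (simpleReflection A i u) (simpleReflection A i v) = form A d u v := by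
  simp only [simpleReflection_apply, map_sub, map_smul, LinearMap.sub_apply, LinearMap.smul_apply,
    h.form_simpleRoot_left, form_simpleRoot_right, simpleCoroot_simpleRoot, h.diag, smul_eq_mul]
  ring

theorem form_apply_apply (h : IsSymmetrizable A d) {I : Set ι} {w : Module.End ℤ (ι → ℤ)}
    (hw : w ∈ parabolic A I) (u v : ι → ℤ) : form A d (w u) (w v) = form A d u v := by
  induction hw using Submonoid.closure_induction_left with
  | one => rfl
  | mul_left x hx y _ ih =>
    obtain ⟨i, hi, rfl⟩ := hx
    rw [Module.End.mul_apply, Module.End.mul_apply, h.form_simpleReflection, ih]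

theorem mul_self (h : IsSymmetrizable A d) (i : ι) :
    simpleReflection A i * simpleReflection A i = 1 :=
  simpleReflection_mul_self A i (h.diag i)

theorem reflection_simpleRoot (h : IsSymmetrizable A d) (i : ι) :
    simpleReflection A i (simpleRoot i) = -simpleRoot i := by
  rw [simpleReflection_simpleRoot, h.diag, two_smul]
  abel

theorem reflection_reflection (h : IsSymmetrizable A d) (i : ι) (v : ι → ℤ) :
    simpleReflection A i (simpleReflection A i v) = v :=
  LinearMap.congr_fun (h.mul_self i) v

/-- By invariance of the form, conjugation by `w` turns the reflection in a root into the reflection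
in its image. The sign `e` lets one lemma serve both the deletion property (`e = 1`) and longest
elements (`e = -1`). -/
theorem mul_reflection_of_apply (h : IsSymmetrizable A d) {I : Set ι} {w : Module.End ℤ (ι → ℤ)}
    (hw : w ∈ parabolic A I) {i k : ι} (e : ℤ) (he : e * e = 1)
    (hik : w (simpleRoot i) = e • simpleRoot k) :
    w * simpleReflection A i = simpleReflection A k * w := by
  have hd : d i = d k := by
    have := h.form_apply_apply hw (simpleRoot i) (simpleRoot i)
    simp only [hik, map_smul, LinearMap.smul_apply, form_simpleRoot_right,
      simpleCoroot_simpleRoot, h.diag, smul_eq_mul] at this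
    linarith [congrArg (· * (d k * 2)) he]
  refine LinearMap.ext fun v => ?_
  have hf := h.form_apply_apply hw v (simpleRoot i)
  rw [hik, map_smul, form_simpleRoot_right, form_simpleRoot_right, hd, smul_eq_mul] at hf
  have hc : e * simpleCoroot A k (w v) = simpleCoroot A i v :=
    mul_left_cancel₀ (h.pos k).ne' (by linear_combination hf)
  simp only [Module.End.mul_apply, simpleReflection_apply, map_sub, map_smul, hik, smul_smul]
  rw [← hc, mul_comm, ← mul_assoc, he, one_mul]

end IsSymmetrizable

namespace IsRootDatum

variable {A : Matrix ι ι ℤ} {d : ι → ℤ} {Φ : Set (ι → ℤ)}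

/-! ### Positive roots and the deletion property. -/

section Basic

theorem apply_mem (h : IsRootDatum A d Φ) {I : Set ι} {w : Module.End ℤ (ι → ℤ)}
    (hw : w ∈ parabolic A I) {v : ι → ℤ} (hv : v ∈ Φ) : w v ∈ Φ := by
  induction hw using Submonoid.closure_induction_left with
  | one => exact hv
  | mul_left x hx y _ ih =>
    obtain ⟨i, hi, rfl⟩ := hx
    exact h.refl i _ ih

theorem exists_inverse (h : IsRootDatum A d Φ) {I : Set ι} {w : Module.End ℤ (ι → ℤ)}
    (hw : w ∈ parabolic A I) : ∃ u ∈ parabolic A I, u * w = 1 ∧ w * u = 1 := by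
  induction hw using Submonoid.closure_induction_left with
  | one => exact ⟨1, one_mem _, one_mul _, one_mul _⟩
  | mul_left x hx y _ ih =>
    obtain ⟨i, hi, rfl⟩ := hx
    obtain ⟨u, hu, h1, h2⟩ := ih
    refine ⟨u * simpleReflection A i, mul_mem hu (simpleReflection_mem_parabolic A hi), ?_, ?_⟩
    · rw [mul_assoc, ← mul_assoc (simpleReflection A i), h.mul_self, one_mul, h1]
    · rw [mul_assoc, ← mul_assoc y, h2, one_mul, h.mul_self]

/-- A simple reflection permutes the positive roots other than its own simple root. -/
theorem reflection_nonneg (h : IsRootDatum A d Φ) {i : ι} {v : ι → ℤ} (hv : v ∈ Φ) (h0 : 0 ≤ v)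
    (hne : v ≠ simpleRoot i) : 0 ≤ simpleReflection A i v := by
  -- Since the root system is reduced, `v` has a nonzero coordinate away from `i`. The reflection
  -- does not change it, so the image cannot be negative.
  obtain ⟨j, hj, hvj⟩ : ∃ j, j ≠ i ∧ v j ≠ 0 := by
    by_contra! hall
    have hle := h.reduced v hv i hall
    have hvi : v i ≠ 0 := fun h' => h.ne_zero v hv (by
      ext j
      by_cases hj : j = i
      · rw [hj, h']; rfl
      · exact hall j hj)
    have h0i : (0 : ℤ) ≤ v i := h0 i
    refine hne (funext fun j => ?_)
    by_cases hj : j = i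
    · subst hj
      simp only [simpleRoot, Pi.single_eq_same]
      omega
    · simp [simpleRoot, hj, hall j hj]
  refine (h.sign _ (h.refl i v hv)).resolve_right fun hle => ?_
  have h1 := hle j
  rw [simpleReflection_apply_of_ne A hj] at h1
  exact hvj (le_antisymm h1 (h0 j))

/-- The deletion property. -/
theorem exists_deletion (h : IsRootDatum A d Φ) (l : List ι) (i : ι)
    (hl : (l.map (simpleReflection A)).prod (simpleRoot i) ≤ 0) :
    ∃ l' : List ι, l' ⊆ l ∧ l'.length + 1 = l.length ∧
      (l'.map (simpleReflection A)).prod =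
        (l.map (simpleReflection A)).prod * simpleReflection A i := by
  induction l with
  | nil => exact (not_simpleRoot_nonpos i hl).elim
  | cons k l ih =>
    have hmem : (l.map (simpleReflection A)).prod ∈ parabolic A Set.univ :=
      mem_parabolic_iff.2 ⟨l, fun _ _ => Set.mem_univ _, rfl⟩
    rcases h.sign _ (h.apply_mem hmem (h.simple i)) with h0 | h0
    -- The sign changes exactly at the letter `k`. Only `αₖ` itself is made negative by this
    -- reflection, so the remaining word carries `αᵢ` to `αₖ` and conjugates `rᵢ` to `rₖ`, which
    -- cancels.
    · by_cases hk : (l.map (simpleReflection A)).prod (simpleRoot i) = simpleRoot k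
      · refine ⟨l, List.subset_cons_self k l, rfl, ?_⟩
        rw [List.map_cons, List.prod_cons, mul_assoc,
          h.mul_reflection_of_apply hmem 1 rfl (by rw [hk, one_smul]), ← mul_assoc, h.mul_self,
          one_mul]
      · have h1 := h.reflection_nonneg (h.apply_mem hmem (h.simple i)) h0 hk
        rw [List.map_cons, List.prod_cons, Module.End.mul_apply] at hl
        exact (h.ne_zero _ (h.refl k _ (h.apply_mem hmem (h.simple i))) (le_antisymm hl h1)).elim
    · obtain ⟨l', hs, hlen, hprod⟩ := ih h0
      refine ⟨k :: l', List.cons_subset_cons k hs, by simp [hlen], ?_⟩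
      simp only [List.map_cons, List.prod_cons, hprod, mul_assoc]

/-- Only the identity maps all simple roots to positive ones. -/
theorem eq_one_of_nonneg (h : IsRootDatum A d Φ) {I : Set ι} {w : Module.End ℤ (ι → ℤ)}
    (hw : w ∈ parabolic A I) (hpos : ∀ i ∈ I, 0 ≤ w (simpleRoot i)) : w = 1 := by
  obtain ⟨l, hl, hlw⟩ := mem_parabolic_iff.1 hw
  induction hn : l.length using Nat.strong_induction_on generalizing l with
  | _ n ih =>
    rcases l.eq_nil_or_concat' with rfl | ⟨l', i, rfl⟩
    · simpa using hlw.symm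
    · have hi : i ∈ I := hl i (by simp)
      have hprod : (l'.map (simpleReflection A)).prod * simpleReflection A i = w := by
        simpa using hlw
      -- Dropping the last letter `i` makes the image of `αᵢ` negative, so deletion yields a word
      -- for `w` shorter by two letters.
      have hneg : (l'.map (simpleReflection A)).prod (simpleRoot i) ≤ 0 := by
        have := hpos i hi
        rw [← hprod, Module.End.mul_apply, h.reflection_simpleRoot, map_neg] at this
        exact neg_nonneg.1 this
      obtain ⟨l'', hs, hlen, hprod'⟩ := h.exists_deletion l' i hneg
      refine ih l''.length ?_ l'' (fun j hj => hl j (by simp [hs hj])) (hprod'.trans hprod) rfl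
      simp at hn
      omega

end Basic

/-! ### Length as the number of inversions. -/

section Inversions

theorem inversions_finite (h : IsRootDatum A d Φ) (w : Module.End ℤ (ι → ℤ)) :
    (inversions Φ w).Finite :=
  h.finite.subset fun _ hv => hv.1

/-- Apart from `αᵢ`, the reflection `rᵢ` permutes the positive roots, hence matches inversions of `w
rᵢ` with inversions of `w`. -/
theorem ncard_inversions_mul_le (h : IsRootDatum A d Φ) (w : Module.End ℤ (ι → ℤ)) (i : ι) :
    (inversions Φ (w * simpleReflection A i)).ncard ≤ (inversions Φ w).ncard + 1 := by
  have hsub : inversions Φ (w * simpleReflection A i) ⊆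
      insert (simpleRoot i) (simpleReflection A i '' inversions Φ w) := by
    rintro v ⟨hv, h0, hle⟩
    by_cases hi : v = simpleRoot i
    · exact Or.inl hi
    · exact Or.inr ⟨simpleReflection A i v, ⟨h.refl i v hv, h.reflection_nonneg hv h0 hi, hle⟩,
        h.reflection_reflection i v⟩
  refine (Set.ncard_le_ncard hsub (((h.inversions_finite w).image _).insert _)).trans ?_
  exact (Set.ncard_insert_le _ _).trans
    (Nat.add_le_add_right (Set.ncard_image_le (h.inversions_finite w)) 1)

theorem ncard_inversions_lt_mul (h : IsRootDatum A d Φ) {I : Set ι} {w : Module.End ℤ (ι → ℤ)}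
    (hw : w ∈ parabolic A I) {i : ι} (hi : 0 ≤ w (simpleRoot i)) :
    (inversions Φ w).ncard < (inversions Φ (w * simpleReflection A i)).ncard := by
  have hinj : Function.Injective (simpleReflection A i) :=
    Function.LeftInverse.injective (h.reflection_reflection i)
  have hsub : insert (simpleRoot i) (simpleReflection A i '' inversions Φ w) ⊆
      inversions Φ (w * simpleReflection A i) := by
    rintro v (rfl | ⟨v, ⟨hv, h0, hle⟩, rfl⟩)
    · refine ⟨h.simple i, simpleRoot_nonneg i, ?_⟩
      rw [Module.End.mul_apply, h.reflection_simpleRoot, map_neg]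
      exact neg_nonpos.2 hi
    · refine ⟨h.refl i v hv, h.reflection_nonneg hv h0 ?_, ?_⟩
      · rintro rfl
        exact h.ne_zero _ (h.apply_mem hw (h.simple i)) (le_antisymm hle hi)
      · rwa [Module.End.mul_apply, h.reflection_reflection]
  have hnot : simpleRoot i ∉ simpleReflection A i '' inversions Φ w := by
    rintro ⟨v, ⟨hv, h0, hle⟩, hvi⟩
    rw [← h.reflection_reflection i v, hvi, h.reflection_simpleRoot] at h0
    exact not_simpleRoot_nonpos i (neg_nonneg.1 h0)
  have := Set.ncard_le_ncard hsub (h.inversions_finite _)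
  rwa [Set.ncard_insert_of_notMem hnot ((h.inversions_finite w).image _),
    Set.ncard_image_of_injective _ hinj, Nat.add_one_le_iff] at this

theorem ncard_inversions_le_length (h : IsRootDatum A d Φ) (l : List ι) :
    (inversions Φ (l.map (simpleReflection A)).prod).ncard ≤ l.length := by
  induction l using List.reverseRecOn with
  | nil =>
    have : inversions Φ (1 : Module.End ℤ (ι → ℤ)) = ∅ := by
      refine Set.eq_empty_of_forall_notMem ?_
      rintro v ⟨hv, h0, hle⟩
      exact h.ne_zero v hv (le_antisymm hle h0)
    simp [this]
  | append_singleton l i ih =>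
    simp only [List.map_append, List.map_cons, List.map_nil, List.prod_append, List.prod_singleton,
      List.length_append, List.length_singleton]
    exact (h.ncard_inversions_mul_le _ i).trans (Nat.add_le_add_right ih 1)

/-- The converse of `ncard_inversions_le_length`. If the prefix keeps the root of the last letter
positive, appending that letter adds an inversion; otherwise deletion provides a shorter word for
the same element. -/
theorem exists_word_length_le (h : IsRootDatum A d Φ) {I : Set ι} (l : List ι)
    (hl : ∀ i ∈ l, i ∈ I) :
    ∃ l' : List ι, (∀ i ∈ l', i ∈ I) ∧
      (l'.map (simpleReflection A)).prod = (l.map (simpleReflection A)).prod ∧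
      l'.length ≤ (inversions Φ (l.map (simpleReflection A)).prod).ncard := by
  induction hn : l.length using Nat.strong_induction_on generalizing l with
  | _ n ih =>
    rcases l.eq_nil_or_concat' with rfl | ⟨l', i, rfl⟩
    · exact ⟨[], by simp⟩
    have hl' : ∀ j ∈ l', j ∈ I := fun j hj => hl j (by simp [hj])
    have hlen : l'.length + 1 = n := by simpa using hn
    have hprod : ((l' ++ [i]).map (simpleReflection A)).prod =
      (l'.map (simpleReflection A)).prod * simpleReflection A i := by simp
    have hmem : (l'.map (simpleReflection A)).prod ∈ parabolic A I :=
      mem_parabolic_iff.2 ⟨l', hl', rfl⟩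
    rcases h.sign _ (h.apply_mem hmem (h.simple i)) with h0 | h0
    · obtain ⟨l'', h1, h2, h3⟩ := ih l'.length (by omega) l' hl' rfl
      refine ⟨l'' ++ [i], ?_, by simp [h2], ?_⟩
      · simp only [List.mem_append, List.mem_singleton]
        rintro j (hj | rfl)
        · exact h1 j hj
        · exact hl j (by simp)
      · rw [hprod, List.length_append, List.length_singleton]
        exact (Nat.add_le_add_right h3 1).trans (h.ncard_inversions_lt_mul hmem h0)
    · obtain ⟨l'', hs, hlen', hprod'⟩ := h.exists_deletion l' i h0
      rw [hprod, ← hprod']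
      exact ih l''.length (by omega) l'' (fun j hj => hl' j (hs hj)) rfl

end Inversions

/-! ### Existence and uniqueness of the longest element. -/

section Longest

/-- An element of `W^I` fixes coordinates outside `I`, so it can invert only positive roots
supported on `I`. All of these are inverted by `w`. -/
theorem isLongest_of_negatesSimple (h : IsRootDatum A d Φ) {I : Set ι}
    {w : Module.End ℤ (ι → ℤ)} (hw : NegatesSimple A I w) : IsLongest A I w := by
  refine ⟨hw.1, fun v hv => ?_⟩
  obtain ⟨l, hl, rfl⟩ := mem_parabolic_iff.1 hv
  obtain ⟨l', hl', hprod, hlen⟩ := h.exists_word_length_le l hl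
  have h1 : weylLength A I (l.map (simpleReflection A)).prod ≤ l'.length :=
    Nat.sInf_le ⟨l', hl', rfl, hprod⟩
  have h2 : (inversions Φ (l.map (simpleReflection A)).prod).ncard ≤ (inversions Φ w).ncard := by
    refine Set.ncard_le_ncard ?_ (h.inversions_finite w)
    rintro v ⟨hvΦ, h0, hle⟩
    refine ⟨hvΦ, h0, hw.apply_nonpos h0 fun i hi => le_antisymm ?_ (h0 i)⟩
    have := hle i
    rwa [apply_of_notMem hv v hi] at this
  have hne : {n | ∃ l : List ι, (∀ i ∈ l, i ∈ I) ∧ l.length = n ∧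
      (l.map (simpleReflection A)).prod = w}.Nonempty := by
    obtain ⟨l, hl, hlw⟩ := mem_parabolic_iff.1 hw.1
    exact ⟨_, l, hl, rfl, hlw⟩
  obtain ⟨lw, -, hlwlen, rfl⟩ := Nat.sInf_mem hne
  refine h1.trans (hlen.trans (h2.trans ?_))
  exact (h.ncard_inversions_le_length lw).trans hlwlen.le

theorem exists_negatesSimple (h : IsRootDatum A d Φ) (I : Set ι) :
    ∃ w, NegatesSimple A I w := by
  have hbdd : ∀ w : Module.End ℤ (ι → ℤ), (inversions Φ w).ncard ≤ Φ.ncard := fun w =>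
    Set.ncard_le_ncard (fun _ hv => hv.1) h.finite
  obtain ⟨w, hw, hmax⟩ : ∃ w ∈ parabolic A I, ∀ u ∈ parabolic A I,
      (inversions Φ u).ncard ≤ (inversions Φ w).ncard := by
    by_contra! hcon
    have : ∀ n : ℕ, ∃ w ∈ parabolic A I, n ≤ (inversions Φ w).ncard := by
      intro n
      induction n with
      | zero => exact ⟨1, one_mem _, Nat.zero_le _⟩
      | succ n ih =>
        obtain ⟨w, hw, hn⟩ := ih
        obtain ⟨u, hu, hlt⟩ := hcon w hw
        exact ⟨u, hu, hn.trans_lt hlt⟩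
    obtain ⟨w, -, hw⟩ := this (Φ.ncard + 1)
    exact absurd (hbdd w) (by omega)
  -- If `w αᵢ` were positive, `w rᵢ` would have more inversions than the maximal number.
  refine ⟨w, hw, fun i hi => ?_⟩
  refine (h.sign _ (h.apply_mem hw (h.simple i))).resolve_left fun h0 => ?_
  exact absurd (hmax _ (mul_mem hw (simpleReflection_mem_parabolic A hi)))
    (not_le.2 (h.ncard_inversions_lt_mul hw h0))

theorem inverse_nonpos (h : IsRootDatum A d Φ) {I : Set ι} {w u : Module.End ℤ (ι → ℤ)}
    (hw : NegatesSimple A I w) (hu : u ∈ parabolic A I) (hwu : w * u = 1) {i : ι} (hi : i ∈ I) :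
    u (simpleRoot i) ≤ 0 := by
  refine (h.sign _ (h.apply_mem hu (h.simple i))).resolve_left fun h0 => ?_
  have h1 := hw.apply_nonpos h0 fun k hk => by
    rw [apply_of_notMem hu _ hk]
    exact Pi.single_eq_of_ne (fun h' => hk (by rwa [h'])) 1
  rw [← Module.End.mul_apply, hwu] at h1
  exact not_simpleRoot_nonpos i h1

/-- Write `w αᵢ = -∑ nₖ αₖ` with `nₖ ≥ 0` and apply the inverse `u`: then `αᵢ = ∑ nₖ (-u αₖ)` is a
sum of nonnegative vectors. A term with `nⱼ ≥ 1` gives a nonzero `-u αⱼ ≤ αᵢ`, which must equal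
`αᵢ`. -/
theorem exists_apply_eq_neg (h : IsRootDatum A d Φ) {I : Set ι} {w : Module.End ℤ (ι → ℤ)}
    (hw : NegatesSimple A I w) {i : ι} (hi : i ∈ I) :
    ∃ j ∈ I, w (simpleRoot i) = -simpleRoot j := by
  obtain ⟨u, hu, huw, hwu⟩ := h.exists_inverse hw.1
  have hroot : ∀ k, k ∉ I → w (simpleRoot i) k = 0 := fun k hk => by
    rw [apply_of_notMem hw.1 _ hk]
    exact Pi.single_eq_of_ne (fun h' => hk (by rwa [h'])) 1
  obtain ⟨j, hj⟩ : ∃ j, w (simpleRoot i) j ≠ 0 := by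
    by_contra! hall
    exact h.ne_zero _ (h.apply_mem hw.1 (h.simple i)) (funext hall)
  have hjI : j ∈ I := by
    by_contra hjI
    exact hj (hroot j hjI)
  have hneg : w (simpleRoot i) j ≤ -1 := by
    have := hw.2 i hi j
    simp only [Pi.zero_apply] at this
    omega
  have hsum : simpleRoot i = ∑ k, (-w (simpleRoot i) k) • -u (simpleRoot k) := by
    have h1 : simpleRoot i = u (w (simpleRoot i)) := (LinearMap.congr_fun huw _).symm
    rw [← sum_smul_simpleRoot (w (simpleRoot i)), map_sum] at h1
    refine h1.trans ?_
    exact Finset.sum_congr rfl fun k _ => by rw [map_smul, neg_smul_neg]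
  have hterm : ∀ k, 0 ≤ (-w (simpleRoot i) k) • -u (simpleRoot k) := fun k => by
    by_cases hk : k ∈ I
    · exact smul_nonneg (neg_nonneg.2 (hw.2 i hi k))
        (neg_nonneg.2 (h.inverse_nonpos hw hu hwu hk))
    · simp [hroot k hk]
  have hle : -u (simpleRoot j) ≤ simpleRoot i := by
    rw [hsum]
    refine le_trans ?_ (Finset.single_le_sum (fun k _ => hterm k) (Finset.mem_univ j))
    intro k
    have := h.inverse_nonpos hw hu hwu hjI k
    simp only [Pi.smul_apply, Pi.neg_apply, smul_eq_mul, Pi.zero_apply] at this ⊢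
    nlinarith
  have h0 : 0 ≤ -u (simpleRoot j) := neg_nonneg.2 (h.inverse_nonpos hw hu hwu hjI)
  have heq : -u (simpleRoot j) = simpleRoot i := by
    have hoff : ∀ k, k ≠ i → (-u (simpleRoot j)) k = 0 := fun k hk =>
      le_antisymm ((hle k).trans (by simp [simpleRoot, hk])) (h0 k)
    have hi0 : (-u (simpleRoot j)) i ≠ 0 := fun hz => by
      refine h.ne_zero _ (h.apply_mem hu (h.simple j)) (neg_eq_zero.1 (funext fun k => ?_))
      by_cases hk : k = i
      · rw [hk, hz]; rfl
      · exact hoff k hk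
    funext k
    by_cases hk : k = i
    · subst hk
      have h1 := hle k
      have h2 := h0 k
      simp only [simpleRoot, Pi.single_eq_same, Pi.zero_apply] at h1 h2 hi0 ⊢
      omega
    · rw [hoff k hk]
      simp [simpleRoot, hk]
  refine ⟨j, hjI, ?_⟩
  rw [← heq, map_neg, ← Module.End.mul_apply, hwu]
  rfl

/-- The second factor sends simple roots to negatives of simple roots and the first makes these
positive again, so the product inverts nothing. This yields both uniqueness and the involution
property. -/
theorem mul_eq_one (h : IsRootDatum A d Φ) {I : Set ι} {w w' : Module.End ℤ (ι → ℤ)}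
    (hw : NegatesSimple A I w) (hw' : NegatesSimple A I w') : w * w' = 1 := by
  refine h.eq_one_of_nonneg (mul_mem hw.1 hw'.1) fun i hi => ?_
  obtain ⟨j, hj, hij⟩ := h.exists_apply_eq_neg hw' hi
  rw [Module.End.mul_apply, hij, map_neg]
  exact neg_nonneg.2 (hw.2 j hj)

theorem negatesSimple_unique (h : IsRootDatum A d Φ) {I : Set ι} {w w' : Module.End ℤ (ι → ℤ)}
    (hw : NegatesSimple A I w) (hw' : NegatesSimple A I w') : w = w' := by
  have h1 := h.mul_eq_one hw hw'
  have h2 := h.mul_eq_one hw' hw'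
  calc w = w * (w' * w') := by rw [h2, mul_one]
    _ = w' := by rw [← mul_assoc, h1, one_mul]

end Longest

end IsRootDatum

end Roots

/-! ### Longest elements and opposition involutions -/

section Longest

variable {ι : Type*} [Fintype ι] [DecidableEq ι]

open scoped Classical in
/-- The longest element of `W^I`. -/
def longest (A : Matrix ι ι ℤ) (I : Set ι) : Module.End ℤ (ι → ℤ) :=
  if h : ∃ w, NegatesSimple A I w then h.choose else 1

open scoped Classical in
/-- The opposition involution `θ_I` of `I`, as a map on all nodes. -/
def opp (A : Matrix ι ι ℤ) (I : Set ι) (i : ι) : ι :=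
  if h : ∃ j ∈ I, longest A I (simpleRoot i) = -simpleRoot j then h.choose else i

/-- All pairs of nodes of `C` and `D` are orthogonal. -/
def Orth (A : Matrix ι ι ℤ) (C D : Set ι) : Prop :=
  ∀ i ∈ C, ∀ j ∈ D, A i j = 0

/-- The span of the simple roots `αᵢ`, `i ∈ C`. -/
def coordSpan (C : Set ι) : Set (ι → ℤ) :=
  {v | ∀ i, i ∉ C → v i = 0}

theorem simpleRoot_mem_coordSpan {C : Set ι} {i : ι} : simpleRoot i ∈ coordSpan C ↔ i ∈ C := by
  constructor
  · intro h
    by_contra hi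
    have := h i hi
    simp [simpleRoot] at this
  · intro hi k hk
    exact Pi.single_eq_of_ne (fun h => hk (by rwa [h])) 1

theorem coordSpan_subset_iff {C D : Set ι} : coordSpan C ⊆ coordSpan D ↔ C ⊆ D :=
  ⟨fun h _ hi => simpleRoot_mem_coordSpan.1 (h (simpleRoot_mem_coordSpan.2 hi)),
    fun h _ hv i hi => hv i fun hC => hi (h hC)⟩

theorem coordSpan_injective : Function.Injective (coordSpan : Set ι → Set (ι → ℤ)) := fun _ _ h =>
  Set.Subset.antisymm (coordSpan_subset_iff.1 h.le) (coordSpan_subset_iff.1 h.ge)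

/-- A linear map which sends `αᵢ`, `i ∈ C`, into `coordSpan D` maps `coordSpan C` to it. -/
theorem apply_mem_coordSpan {C D : Set ι} {w : Module.End ℤ (ι → ℤ)}
    (hw : ∀ i ∈ C, w (simpleRoot i) ∈ coordSpan D) {v : ι → ℤ} (hv : v ∈ coordSpan C) :
    w v ∈ coordSpan D := by
  intro k hk
  rw [← sum_smul_simpleRoot v, map_sum, Finset.sum_apply]
  refine Finset.sum_eq_zero fun i _ => ?_
  by_cases hi : i ∈ C
  · rw [map_smul, Pi.smul_apply, hw i hi k hk, smul_zero]
  · rw [hv i hi, zero_smul, map_zero]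
    rfl

theorem neg_mem_coordSpan {C : Set ι} {v : ι → ℤ} (hv : v ∈ coordSpan C) :
    -v ∈ coordSpan C := fun i hi => by rw [Pi.neg_apply, hv i hi, neg_zero]

theorem apply_eq_self {A : Matrix ι ι ℤ} {I : Set ι} {w : Module.End ℤ (ι → ℤ)}
    (hw : w ∈ parabolic A I) {v : ι → ℤ} (hv : ∀ i ∈ I, simpleCoroot A i v = 0) : w v = v := by
  induction hw using Submonoid.closure_induction_left with
  | one => rfl
  | mul_left x hx y _ ih =>
    obtain ⟨i, hi, rfl⟩ := hx
    rw [Module.End.mul_apply, ih, simpleReflection_apply, hv i hi, zero_smul, sub_zero]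

theorem Orth.apply_eq_self {A : Matrix ι ι ℤ} {C D : Set ι} (h : Orth A C D)
    {w : Module.End ℤ (ι → ℤ)} (hw : w ∈ parabolic A D) {v : ι → ℤ} (hv : v ∈ coordSpan C) :
    w v = v := by
  refine Dynkin.apply_eq_self hw fun j hj => ?_
  rw [simpleCoroot_apply]
  refine Finset.sum_eq_zero fun i _ => ?_
  by_cases hi : i ∈ C
  · rw [h i hi j hj, mul_zero]
  · rw [hv i hi, zero_mul]

namespace IsRootDatum

variable {A : Matrix ι ι ℤ} {d : ι → ℤ} {Φ : Set (ι → ℤ)}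

theorem longest_spec (h : IsRootDatum A d Φ) (I : Set ι) : NegatesSimple A I (longest A I) := by
  rw [longest, dif_pos (h.exists_negatesSimple I)]
  exact (h.exists_negatesSimple I).choose_spec

theorem eq_longest (h : IsRootDatum A d Φ) {I : Set ι} {w : Module.End ℤ (ι → ℤ)}
    (hw : NegatesSimple A I w) : w = longest A I :=
  h.negatesSimple_unique hw (h.longest_spec I)

theorem longest_mem (h : IsRootDatum A d Φ) (I : Set ι) : longest A I ∈ parabolic A I :=
  (h.longest_spec I).1

theorem longest_mul_self (h : IsRootDatum A d Φ) (I : Set ι) : longest A I * longest A I = 1 :=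
  h.mul_eq_one (h.longest_spec I) (h.longest_spec I)

theorem longest_longest (h : IsRootDatum A d Φ) (I : Set ι) (v : ι → ℤ) :
    longest A I (longest A I v) = v :=
  LinearMap.congr_fun (h.longest_mul_self I) v

theorem opp_spec (h : IsRootDatum A d Φ) {I : Set ι} {i : ι} (hi : i ∈ I) :
    opp A I i ∈ I ∧ longest A I (simpleRoot i) = -simpleRoot (opp A I i) := by
  have hex := h.exists_apply_eq_neg (h.longest_spec I) hi
  rw [opp, dif_pos hex]
  exact hex.choose_spec

theorem opp_mem (h : IsRootDatum A d Φ) {I : Set ι} {i : ι} (hi : i ∈ I) : opp A I i ∈ I :=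
  (h.opp_spec hi).1

theorem longest_simpleRoot (h : IsRootDatum A d Φ) {I : Set ι} {i : ι} (hi : i ∈ I) :
    longest A I (simpleRoot i) = -simpleRoot (opp A I i) :=
  (h.opp_spec hi).2

theorem opp_eq_iff (h : IsRootDatum A d Φ) {I : Set ι} {i j : ι} (hi : i ∈ I) :
    opp A I i = j ↔ longest A I (simpleRoot i) = -simpleRoot j := by
  rw [h.longest_simpleRoot hi, neg_inj, simpleRoot_injective.eq_iff]

theorem opp_opp (h : IsRootDatum A d Φ) {I : Set ι} {i : ι} (hi : i ∈ I) :
    opp A I (opp A I i) = i := by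
  rw [h.opp_eq_iff (h.opp_mem hi), ← neg_eq_iff_eq_neg, ← map_neg, ← h.longest_simpleRoot hi,
    h.longest_longest]

theorem d_opp (h : IsRootDatum A d Φ) {I : Set ι} {i : ι} (hi : i ∈ I) :
    d (opp A I i) = d i := by
  have := h.form_apply_apply (h.longest_mem I) (simpleRoot i) (simpleRoot i)
  simp only [h.longest_simpleRoot hi, map_neg, LinearMap.neg_apply, form_simpleRoot_right,
    simpleCoroot_simpleRoot, h.diag] at this
  linarith

theorem cartan_opp (h : IsRootDatum A d Φ) {I : Set ι} {i j : ι} (hi : i ∈ I) (hj : j ∈ I) :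
    A (opp A I i) (opp A I j) = A i j := by
  have := h.form_apply_apply (h.longest_mem I) (simpleRoot i) (simpleRoot j)
  simp only [h.longest_simpleRoot hi, h.longest_simpleRoot hj, map_neg, LinearMap.neg_apply,
    form_simpleRoot_right, simpleCoroot_simpleRoot, neg_neg, h.d_opp hj] at this
  exact mul_left_cancel₀ (h.pos j).ne' this

theorem opp_image_subset (h : IsRootDatum A d Φ) {I J : Set ι} (hJ : J ⊆ I) :
    opp A I '' J ⊆ I := by
  rintro _ ⟨j, hj, rfl⟩
  exact h.opp_mem (hJ hj)

theorem opp_image_opp_image (h : IsRootDatum A d Φ) {I J : Set ι} (hJ : J ⊆ I) :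
    opp A I '' (opp A I '' J) = J := by
  rw [Set.image_image]
  exact (Set.image_congr fun j hj => h.opp_opp (hJ hj)).trans (Set.image_id' J)

theorem opp_image_self (h : IsRootDatum A d Φ) (I : Set ι) : opp A I '' I = I := by
  refine Set.Subset.antisymm (h.opp_image_subset subset_rfl) fun i hi => ?_
  exact ⟨opp A I i, h.opp_mem hi, h.opp_opp hi⟩

/-- The defining formula already says that `w` negates the simple roots of `I`, and only one element
of `W^I` does so. -/
theorem isTheta_apply (h : IsRootDatum A d Φ) {I : Set ι} {θ : Equiv.Perm I}
    (hθ : IsTheta A I θ) (i : I) : (θ i : ι) = opp A I i := by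
  obtain ⟨w, ⟨hw, -⟩, hwi⟩ := hθ.longest
  have hneg : NegatesSimple A I w := ⟨hw, fun i hi => by
    have := hwi ⟨i, hi⟩
    rw [eq_neg_iff_add_eq_zero, add_comm, ← eq_neg_iff_add_eq_zero] at this
    rw [this]
    exact neg_nonpos.2 (simpleRoot_nonneg _)⟩
  refine ((h.opp_eq_iff i.2).2 ?_).symm
  rw [hwi i, neg_neg, ← h.eq_longest hneg]

theorem isThetaImage_iff (h : IsRootDatum A d Φ) {I J K : Set ι} (hJ : J ⊆ I) :
    IsThetaImage A I J K ↔ K = opp A I '' J := by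
  have key : ∀ θ : Equiv.Perm I, (∀ i : I, (θ i : ι) = opp A I i) →
      {k | ∃ i : I, (i : ι) ∈ J ∧ (θ i : ι) = k} = opp A I '' J := by
    intro θ hθ
    ext k
    constructor
    · rintro ⟨i, hi, rfl⟩
      exact ⟨i, hi, (hθ i).symm⟩
    · rintro ⟨i, hi, rfl⟩
      exact ⟨⟨i, hJ hi⟩, hi, hθ _⟩
  constructor
  · rintro ⟨θ, hθ, rfl⟩
    exact key θ (h.isTheta_apply hθ)
  · intro hK
    let f : I → I := fun i => ⟨opp A I i, h.opp_mem i.2⟩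
    have hf : Function.Involutive f := fun i => Subtype.ext (h.opp_opp i.2)
    refine ⟨hf.toPerm, ⟨fun i j => h.cartan_opp i.2 j.2, longest A I,
      h.isLongest_of_negatesSimple (h.longest_spec I), fun i => ?_⟩, ?_⟩
    · rw [h.longest_simpleRoot i.2, neg_neg]
      rfl
    · rw [hK, key _ fun _ => rfl]

/-- The conjugate of `w₀^J` by `w₀^I` lies in the parabolic subgroup of `θ_I(J)` and negates its
simple roots; uniqueness identifies it. -/
theorem longest_mul_longest (h : IsRootDatum A d Φ) {I J : Set ι} (hJ : J ⊆ I) :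
    longest A I * longest A J = longest A (opp A I '' J) * longest A I := by
  have hmem : ∀ u ∈ parabolic A J, longest A I * u * longest A I ∈
      parabolic A (opp A I '' J) := by
    intro u hu
    induction hu using Submonoid.closure_induction_left with
    | one =>
      rw [mul_one, h.longest_mul_self]
      exact one_mem _
    | mul_left x hx y _ ih =>
      obtain ⟨j, hj, rfl⟩ := hx
      rw [← mul_assoc, h.mul_reflection_of_apply (h.longest_mem I) (-1) (by norm_num)
        (by rw [h.longest_simpleRoot (hJ hj), neg_one_smul]), mul_assoc, mul_assoc,
        ← mul_assoc (longest A I)]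
      exact mul_mem (simpleReflection_mem_parabolic A ⟨j, hj, rfl⟩) ih
  have hneg : NegatesSimple A (opp A I '' J) (longest A I * longest A J * longest A I) := by
    refine ⟨hmem _ (h.longest_mem J), ?_⟩
    rintro _ ⟨j, hj, rfl⟩
    rw [Module.End.mul_apply, Module.End.mul_apply, h.longest_simpleRoot (h.opp_mem (hJ hj)),
      h.opp_opp (hJ hj), map_neg, h.longest_simpleRoot hj, neg_neg,
      h.longest_simpleRoot (hJ (h.opp_mem hj))]
    exact neg_nonpos.2 (simpleRoot_nonneg _)
  rw [← h.eq_longest hneg, mul_assoc _ (longest A I), h.longest_mul_self, mul_one]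

theorem orth_symm (h : IsRootDatum A d Φ) {C D : Set ι} (hCD : Orth A C D) : Orth A D C := by
  intro j hj i hi
  have := h.symm i j
  rw [hCD i hi j hj, zero_mul, eq_comm, mul_eq_zero] at this
  exact this.resolve_right (h.pos i).ne'

/-- Each factor fixes the roots of the other part, so the product negates the simple roots of both.
-/
theorem longest_union (h : IsRootDatum A d Φ) {C D : Set ι} (hCD : Orth A C D) :
    longest A (C ∪ D) = longest A C * longest A D := by
  refine (h.eq_longest ⟨mul_mem (parabolic_mono A Set.subset_union_left (h.longest_mem C))
    (parabolic_mono A Set.subset_union_right (h.longest_mem D)), ?_⟩).symm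
  rintro i (hi | hi)
  · rw [Module.End.mul_apply,
      hCD.apply_eq_self (h.longest_mem D) (simpleRoot_mem_coordSpan.2 hi)]
    exact (h.longest_spec C).2 i hi
  · rw [Module.End.mul_apply, h.longest_simpleRoot hi, map_neg, (h.orth_symm hCD).apply_eq_self
      (h.longest_mem C) (simpleRoot_mem_coordSpan.2 (h.opp_mem hi))]
    exact neg_nonpos.2 (simpleRoot_nonneg _)

theorem opp_union (h : IsRootDatum A d Φ) {C D : Set ι} (hCD : Orth A C D) {i : ι} (hi : i ∈ C) :
    opp A (C ∪ D) i = opp A C i := by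
  rw [h.opp_eq_iff (Or.inl hi), h.longest_union hCD, Module.End.mul_apply,
    hCD.apply_eq_self (h.longest_mem D) (simpleRoot_mem_coordSpan.2 hi), h.longest_simpleRoot hi]

theorem longest_comm (h : IsRootDatum A d Φ) {C D : Set ι} (hCD : Orth A C D) :
    Commute (longest A C) (longest A D) := by
  rw [Commute, SemiconjBy, ← h.longest_union hCD, Set.union_comm, h.longest_union (h.orth_symm hCD)]

theorem longest_image_coordSpan (h : IsRootDatum A d Φ) {I J : Set ι} (hJ : J ⊆ I) :
    longest A I '' coordSpan J = coordSpan (opp A I '' J) := by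
  have key : ∀ K ⊆ I, ∀ v ∈ coordSpan K, longest A I v ∈ coordSpan (opp A I '' K) := by
    intro K hK v hv
    refine apply_mem_coordSpan (fun i hi => ?_) hv
    rw [h.longest_simpleRoot (hK hi)]
    exact neg_mem_coordSpan (simpleRoot_mem_coordSpan.2 ⟨i, hi, rfl⟩)
  refine Set.Subset.antisymm ?_ fun v hv => ⟨longest A I v, ?_, h.longest_longest I v⟩
  · rintro _ ⟨v, hv, rfl⟩
    exact key J hJ v hv
  · have := key _ (h.opp_image_subset hJ) v hv
    rwa [h.opp_image_opp_image hJ] at this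

end IsRootDatum

end Longest

/-! ### Connected subdiagrams -/

section Connected

variable {ι κ : Type*} [Fintype ι] [DecidableEq ι] [Fintype κ] [DecidableEq κ]
  {A : Matrix ι ι ℤ} {d : ι → ℤ} {Φ : Set (ι → ℤ)}
  {B : Matrix κ κ ℤ} {e : κ → ℤ} {Ψ : Set (κ → ℤ)}

namespace IsRootDatum

theorem ne_of_orth (h : IsRootDatum A d Φ) {i j : ι} (hij : A i j = 0) : i ≠ j := by
  rintro rfl
  exact absurd (h.diag i) (by omega)

/-- A subdiagram is connected iff it has no nontrivial orthogonal decomposition. -/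
theorem isConn_iff (h : IsRootDatum A d Φ) {S : Set ι} :
    IsConn A S ↔ S.Nonempty ∧ ∀ P ⊆ S, P.Nonempty → Orth A P (S \ P) → P = S := by
  constructor
  · intro hS
    refine ⟨Set.nonempty_coe_sort.1 hS.nonempty, fun P hP ⟨x, hx⟩ hO => ?_⟩
    refine Set.Subset.antisymm hP fun y hy => ?_
    have hr := hS.preconnected ⟨x, hP hx⟩ ⟨y, hy⟩
    rw [SimpleGraph.reachable_iff_reflTransGen] at hr
    have : ∀ z : S, Relation.ReflTransGen ((graph A).induce S).Adj ⟨x, hP hx⟩ z → z.1 ∈ P := by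
      intro z hz
      induction hz with
      | refl => exact hx
      | @tail b c _ hbc ih =>
        by_contra hc
        have h1 := hO b ih c ⟨c.2, hc⟩
        have h2 := h.orth_symm hO c ⟨c.2, hc⟩ b ih
        simp [graph, h1, h2] at hbc
    exact this _ hr
  · rintro ⟨⟨x, hx⟩, hP⟩
    have hall : ∀ x (hx : x ∈ S) y (hy : y ∈ S),
        ((graph A).induce S).Reachable ⟨x, hx⟩ ⟨y, hy⟩ := by
      intro x hx y hy
      have := hP {z | ∃ hz : z ∈ S, ((graph A).induce S).Reachable ⟨x, hx⟩ ⟨z, hz⟩}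
        (fun z hz => hz.1) ⟨x, hx, SimpleGraph.Reachable.refl _⟩ ?_
      · exact (this.ge hy).2
      · rintro i ⟨hi, hr⟩ j ⟨hj, hnr⟩
        by_contra hij
        have hne : i ≠ j := by
          rintro rfl
          exact hnr ⟨hj, hr⟩
        refine hnr ⟨hj, hr.trans (SimpleGraph.Adj.reachable ?_)⟩
        simp [graph, hne, hij]
    have : Nonempty S := ⟨⟨x, hx⟩⟩
    exact ⟨fun x y => hall x.1 x.2 y.1 y.2⟩

theorem isConn_singleton (h : IsRootDatum A d Φ) (i : ι) : IsConn A {i} := by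
  rw [h.isConn_iff]
  exact ⟨Set.singleton_nonempty i, fun P hP hne _ => (Set.subset_singleton_iff_eq.1 hP).resolve_left
    hne.ne_empty⟩

/-- A part `P` split off orthogonally contains or misses each of `C` and `D`. Containing only one of
them would make `C` and `D` orthogonal. -/
theorem isConn_union (h : IsRootDatum A d Φ) {C D : Set ι} (hC : IsConn A C) (hD : IsConn A D)
    (hCD : ¬ Orth A C D) : IsConn A (C ∪ D) := by
  rw [h.isConn_iff] at hC hD ⊢
  refine ⟨hC.1.mono Set.subset_union_left, fun P hP hne hO => ?_⟩
  have key : ∀ E ⊆ C ∪ D, (∀ Q ⊆ E, Q.Nonempty → Orth A Q (E \ Q) → Q = E) →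
      Disjoint P E ∨ E ⊆ P := by
    intro E hE hcl
    by_cases hd : (P ∩ E).Nonempty
    · right
      have := hcl (P ∩ E) Set.inter_subset_right hd fun i hi j hj =>
        hO i hi.1 j ⟨hE hj.1, fun h' => hj.2 ⟨h', hj.1⟩⟩
      rw [← this]
      exact Set.inter_subset_left
    · left
      exact Set.disjoint_iff_inter_eq_empty.2 (Set.not_nonempty_iff_eq_empty.1 hd)
  have hO' : ∀ i ∈ P, ∀ j ∈ C ∪ D, j ∉ P → A i j = 0 := fun i hi j hj hjP => hO i hi j ⟨hj, hjP⟩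
  rcases key C Set.subset_union_left hC.2 with h1 | h1 <;>
    rcases key D Set.subset_union_right hD.2 with h2 | h2
  · obtain ⟨x, hx⟩ := hne
    exact ((hP hx).elim (Set.disjoint_left.1 h1 hx) (Set.disjoint_left.1 h2 hx)).elim
  · refine (hCD (h.orth_symm fun i hi j hj => hO' i (h2 hi) j (Or.inl hj) fun hjP => ?_)).elim
    exact Set.disjoint_left.1 h1 hjP hj
  · refine (hCD fun i hi j hj => hO' i (h1 hi) j (Or.inr hj) fun hjP => ?_).elim
    exact Set.disjoint_left.1 h2 hjP hj
  · exact Set.Subset.antisymm hP (Set.union_subset h1 h2)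

theorem not_isConn_union_iff (h : IsRootDatum A d Φ) {C D : Set ι} (hC : IsConn A C)
    (hD : IsConn A D) : ¬ IsConn A (C ∪ D) ↔ Orth A C D := by
  refine ⟨fun hn => by_contra fun hO => hn (h.isConn_union hC hD hO), fun hO hn => ?_⟩
  have hdisj : ∀ i ∈ C, i ∉ D := fun i hi hi' => h.ne_of_orth (hO i hi i hi') rfl
  have := (h.isConn_iff.1 hn).2 C Set.subset_union_left (h.isConn_iff.1 hC).1
    fun i hi j hj => hO i hi j (hj.1.resolve_left hj.2)
  obtain ⟨x, hx⟩ := (h.isConn_iff.1 hD).1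
  exact hdisj x (this.ge (Or.inr hx)) hx

theorem isConn_image (h : IsRootDatum A d Φ) (h' : IsRootDatum B e Ψ) (f : ι → κ) {C : Set ι}
    (hC : IsConn A C) (hf : ∀ i ∈ C, ∀ j ∈ C, B (f i) (f j) = 0 → A i j = 0) :
    IsConn B (f '' C) := by
  rw [h.isConn_iff] at hC
  rw [h'.isConn_iff]
  refine ⟨hC.1.image f, fun P hP ⟨x, hx⟩ hO => ?_⟩
  obtain ⟨i, hi, rfl⟩ := hP hx
  have := hC.2 (C ∩ f ⁻¹' P) Set.inter_subset_left ⟨i, hi, hx⟩ fun i hi j hj =>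
    hf i hi.1 j hj.1 (hO _ hi.2 _ ⟨⟨j, hj.1, rfl⟩, fun hjP => hj.2 ⟨hj.1, hjP⟩⟩)
  refine Set.Subset.antisymm hP ?_
  rintro _ ⟨j, hj, rfl⟩
  exact (this.ge hj).2

theorem isConn_opp_image (h : IsRootDatum A d Φ) {I J : Set ι} (hJ : J ⊆ I) (hc : IsConn A J) :
    IsConn A (opp A I '' J) :=
  h.isConn_image h _ hc fun i hi j hj hij => by rwa [h.cartan_opp (hJ hi) (hJ hj)] at hij

/-- The subdiagram `θ_I(J)`. -/
def oppSub (h : IsRootDatum A d Φ) (I : Set ι) (J : ConnSub A) (hJ : J.1 ⊆ I) : ConnSub A :=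
  ⟨opp A I '' J.1, h.isConn_opp_image hJ J.2⟩

end IsRootDatum

theorem subset_of_mem_components {S : Set ι} {C : ConnSub A} (hC : C ∈ components A S) :
    C.1 ⊆ S := (mem_components.1 hC).1

theorem ConnSub.nonempty (C : ConnSub A) : C.1.Nonempty :=
  Set.nonempty_coe_sort.1 C.2.nonempty

namespace IsRootDatum

theorem subset_component (h : IsRootDatum A d Φ) {S : Set ι} {C D : ConnSub A}
    (hC : C ∈ components A S) (hD : D.1 ⊆ S) (hCD : ¬ Orth A C.1 D.1) : D.1 ⊆ C.1 := by
  have hC' := mem_components.1 hC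
  exact Set.subset_union_right.trans (hC'.2 (y := ⟨C.1 ∪ D.1, h.isConn_union C.2 D.2 hCD⟩)
    (Set.union_subset hC'.1 hD) (Set.subset_union_left (t := D.1)))

theorem exists_component {S : Set ι} (D : ConnSub A) (hD : D.1 ⊆ S) :
    ∃ C ∈ components A S, D.1 ⊆ C.1 := by
  obtain ⟨C, hDC, hC⟩ := (Set.toFinite {C : ConnSub A | C.1 ⊆ S}).exists_le_maximal hD
  exact ⟨C, mem_components.2 hC, hDC⟩

theorem exists_mem_component (h : IsRootDatum A d Φ) {S : Set ι} {i : ι} (hi : i ∈ S) :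
    ∃ C ∈ components A S, i ∈ C.1 := by
  obtain ⟨C, hC, hiC⟩ := exists_component ⟨{i}, h.isConn_singleton i⟩
    (Set.singleton_subset_iff.2 hi)
  exact ⟨C, hC, hiC rfl⟩

theorem not_orth_of_mem (h : IsRootDatum A d Φ) {C D : Set ι} {i : ι} (hC : i ∈ C) (hD : i ∈ D) :
    ¬ Orth A C D := fun hO => h.ne_of_orth (hO i hC i hD) rfl

theorem orth_component (h : IsRootDatum A d Φ) {S : Set ι} {C : ConnSub A}
    (hC : C ∈ components A S) : Orth A C.1 (S \ C.1) := by
  intro i hi j hj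
  by_contra hij
  refine hj.2 (h.subset_component hC (D := ⟨{j}, h.isConn_singleton j⟩)
    (Set.singleton_subset_iff.2 hj.1) (fun hO => hij (hO i hi j rfl)) rfl)

theorem orth_components (h : IsRootDatum A d Φ) {S : Set ι} {C D : ConnSub A}
    (hC : C ∈ components A S) (hD : D ∈ components A S) (hne : C ≠ D) : Orth A C.1 D.1 :=
  (h.not_isConn_union_iff C.2 D.2).1 (not_isConn_union hC hD hne)

/-- `S` is the orthogonal union of `C` and the rest, and the longest element of the rest fixes the
roots of `C`. -/
theorem opp_component (h : IsRootDatum A d Φ) {S : Set ι} {C : ConnSub A}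
    (hC : C ∈ components A S) {i : ι} (hi : i ∈ C.1) : opp A S i = opp A C.1 i := by
  have := h.opp_union (h.orth_component hC) hi
  rwa [Set.union_sdiff_cancel (subset_of_mem_components hC)] at this

theorem opp_image_component (h : IsRootDatum A d Φ) {S : Set ι} {C : ConnSub A}
    (hC : C ∈ components A S) {J : Set ι} (hJ : J ⊆ C.1) : opp A S '' J = opp A C.1 '' J :=
  Set.image_congr fun _ hi => h.opp_component hC (hJ hi)

theorem oppSub_mem_components (h : IsRootDatum A d Φ) {I J : Set ι} (hJ : J ⊆ I) {D : ConnSub A}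
    (hD : D ∈ components A J) :
    h.oppSub I D ((subset_of_mem_components hD).trans hJ) ∈ components A (opp A I '' J) := by
  rw [mem_components]
  refine ⟨Set.image_mono (subset_of_mem_components hD), fun E hE hDE => ?_⟩
  have hEI : E.1 ⊆ I := Set.Subset.trans hE (h.opp_image_subset hJ)
  have hE' : (h.oppSub I E hEI).1 ⊆ J := by
    have := Set.image_mono (f := opp A I) hE
    rwa [h.opp_image_opp_image hJ] at this
  have hDE' : D.1 ⊆ (h.oppSub I E hEI).1 := by
    have := Set.image_mono (f := opp A I) hDE
    rwa [oppSub, h.opp_image_opp_image ((subset_of_mem_components hD).trans hJ)] at this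
  have hle := (mem_components.1 hD).2 (y := h.oppSub I E hEI) hE' hDE'
  have := Set.image_mono (f := opp A I) hle
  rwa [oppSub, h.opp_image_opp_image hEI] at this

end IsRootDatum

end Connected

/-! ### The root datum of a simply laced positive definite matrix -/

section SimplyLaced

variable {κ : Type*} [Fintype κ] [DecidableEq κ] {B : Matrix κ κ ℤ}

/-- `B` is a symmetric generalized Cartan matrix of finite type. -/
structure IsFiniteSymmetric (B : Matrix κ κ ℤ) : Prop where
  diag : ∀ y, B y y = 2
  symm : ∀ y z, B y z = B z y
  nonpos : ∀ y z, y ≠ z → B y z ≤ 0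
  pos : ∀ v, v ≠ 0 → 0 < form B 1 v v

/-- The vectors of squared length `2`. -/
def shortVectors (B : Matrix κ κ ℤ) : Set (κ → ℤ) := {v | form B 1 v v = 2}

namespace IsFiniteSymmetric

theorem isSymmetrizable (h : IsFiniteSymmetric B) : IsSymmetrizable B 1 where
  diag := h.diag
  pos _ := zero_lt_one
  symm y z := by rw [h.symm]; rfl

theorem form_smul_simpleRoot (h : IsFiniteSymmetric B) (a b : ℤ) (y : κ) :
    form B 1 (a • simpleRoot y) (b • simpleRoot y) = 2 * (a * b) := by
  simp only [map_smul, LinearMap.smul_apply, form_simpleRoot_right, simpleCoroot_simpleRoot, h.diag,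
    smul_eq_mul, Pi.one_apply]
  ring

/-- The diagonal terms are twice a square, and the symmetric cross terms occur twice. -/
theorem even_form (h : IsFiniteSymmetric B) (v : κ → ℤ) : Even (form B 1 v v) := by
  rw [← sum_smul_simpleRoot v]
  refine Finset.sum_induction _ (fun v => Even (form B 1 v v)) ?_ (by simp) fun y _ => ?_
  · intro u v hu hv
    simp only [map_add, LinearMap.add_apply, h.isSymmetrizable.form_comm v u]
    obtain ⟨a, ha⟩ := hu
    obtain ⟨b, hb⟩ := hv
    exact ⟨a + b + form B 1 u v, by rw [ha, hb]; ring⟩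
  · rw [h.form_smul_simpleRoot]
    exact even_two_mul _

theorem two_le_form (h : IsFiniteSymmetric B) {v : κ → ℤ} (hv : v ≠ 0) : 2 ≤ form B 1 v v := by
  obtain ⟨k, hk⟩ := h.even_form v
  have := h.pos v hv
  omega

theorem form_nonneg (h : IsFiniteSymmetric B) (v : κ → ℤ) : 0 ≤ form B 1 v v := by
  by_cases hv : v = 0
  · simp [hv]
  · exact (h.pos v hv).le

/-- The two parts have disjoint supports, so only off-diagonal entries, which are nonpositive,
contribute. -/
theorem form_posPart_negPart (h : IsFiniteSymmetric B) (v : κ → ℤ) : form B 1 v⁺ v⁻ ≤ 0 := by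
  rw [form_apply]
  refine Finset.sum_nonpos fun z _ => ?_
  rw [simpleCoroot_apply, Pi.one_apply, one_mul, Finset.sum_mul]
  refine Finset.sum_nonpos fun y _ => ?_
  have hy : 0 ≤ v⁺ y := posPart_nonneg v y
  have hz : 0 ≤ v⁻ z := negPart_nonneg v z
  by_cases hyz : y = z
  · subst hyz
    have : v⁺ y * v⁻ y = 0 := by
      rw [Pi.posPart_apply, Pi.negPart_apply]
      rcases le_total 0 (v y) with h0 | h0
      · rw [negPart_eq_zero.2 h0, mul_zero]
      · rw [posPart_eq_zero.2 h0, zero_mul]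
    rw [mul_right_comm, this, zero_mul]
  · exact mul_nonpos_of_nonpos_of_nonneg
      (mul_nonpos_of_nonneg_of_nonpos hy (h.nonpos y z hyz)) hz

/-- By definiteness a vector is determined by its pairings with the simple coroots. For a vector of
norm `2`, nonnegativity of the norms of `v ± α` bounds each pairing by `2` in absolute value. -/
theorem shortVectors_finite (h : IsFiniteSymmetric B) : (shortVectors B).Finite := by
  let f : (κ → ℤ) →ₗ[ℤ] (κ → ℤ) := LinearMap.pi (simpleCoroot B)
  have hf : Function.Injective f := by
    refine (injective_iff_map_eq_zero f).2 fun v hv => ?_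
    by_contra hne
    refine (h.pos v hne).ne' ?_
    rw [form_apply]
    refine Finset.sum_eq_zero fun z _ => ?_
    have : simpleCoroot B z v = 0 := congrFun hv z
    rw [this, zero_mul, mul_zero]
  refine Set.Finite.subset ((Set.finite_Icc (fun _ => -2 : κ → ℤ) (fun _ => 2)).preimage
    hf.injOn) fun v hv => ?_
  have hv2 : form B 1 v v = 2 := hv
  have key : ∀ z, -2 ≤ simpleCoroot B z v ∧ simpleCoroot B z v ≤ 2 := by
    intro z
    have h1 := h.form_nonneg (v - simpleRoot z)
    have h2 := h.form_nonneg (v + simpleRoot z)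
    simp only [map_sub, map_add, LinearMap.sub_apply, LinearMap.add_apply, form_simpleRoot_right,
      h.isSymmetrizable.form_simpleRoot_left, simpleCoroot_simpleRoot, h.diag, hv2,
      Pi.one_apply] at h1 h2
    omega
  exact ⟨fun z => (key z).1, fun z => (key z).2⟩

theorem isRootDatum (h : IsFiniteSymmetric B) : IsRootDatum B 1 (shortVectors B) where
  toIsSymmetrizable := h.isSymmetrizable
  finite := h.shortVectors_finite
  simple y := by
    have := h.form_smul_simpleRoot 1 1 y
    rwa [one_smul] at this
  refl y v hv := (h.isSymmetrizable.form_simpleReflection y v v).trans hv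
  ne_zero v hv hz := by
    rw [hz, shortVectors, Set.mem_ofPred_eq, map_zero] at hv
    exact absurd hv (by simp)
  sign v hv := by
    rw [← negPart_eq_zero, ← posPart_eq_zero]
    -- If both parts are nonzero, each has norm at least `2` and their product is nonpositive, so
    -- `v` would have norm at least `4`.
    by_contra! hne
    have h1 := h.two_le_form hne.1
    have h2 := h.two_le_form hne.2
    have h3 := h.form_posPart_negPart v
    have h4 : form B 1 v v = 2 := hv
    rw [← posPart_sub_negPart v] at h4
    simp only [map_sub, LinearMap.sub_apply, h.isSymmetrizable.form_comm v⁻ v⁺] at h4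
    linarith
  reduced v hv y hy := by
    have h1 : form B 1 v v = 2 := hv
    have h2 : v = v y • simpleRoot y := by
      ext z
      by_cases hz : z = y
      · simp [hz, simpleRoot]
      · simp [hz, simpleRoot, hy z hz]
    rw [h2, h.form_smul_simpleRoot] at h1
    nlinarith

end IsFiniteSymmetric

end SimplyLaced

/-! ### Folding root data -/

namespace Folding

variable {X Y : Type*} [Fintype X] [DecidableEq X] [Fintype Y] [DecidableEq Y]
  {A : Matrix X X ℤ} {B : Matrix Y Y ℤ} (F : Folding A B)

/-- The map from `Y` to `X` whose fibres are the orbits `σ(i)`. -/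
def proj (y : Y) : X := F.σ.symm (Quotient.mk _ y)

theorem σ_eq_iff (i : X) (y : Y) : F.σ i = Quotient.mk _ y ↔ F.proj y = i := by
  rw [proj, Equiv.symm_apply_eq, eq_comm]

theorem mem_image {I : Set X} {y : Y} : y ∈ F.image I ↔ F.proj y ∈ I := by
  simp [image, σ_eq_iff]

theorem proj_surjective : Function.Surjective F.proj := by
  intro i
  obtain ⟨y, hy⟩ := Quotient.exists_rep (F.σ i)
  exact ⟨y, (F.σ_eq_iff i y).1 hy.symm⟩

theorem image_mono {I J : Set X} (h : I ⊆ J) : F.image I ⊆ F.image J := fun _ hy =>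
  F.mem_image.2 (h (F.mem_image.1 hy))

theorem image_injective : Function.Injective F.image := by
  intro I J h
  ext i
  obtain ⟨y, rfl⟩ := F.proj_surjective i
  rw [← F.mem_image, h, F.mem_image]

/-- The orbit `σ(i)`. -/
def fibre (i : X) : Finset Y := Finset.univ.filter fun y => F.proj y = i

theorem mem_fibre {i : X} {y : Y} : y ∈ F.fibre i ↔ F.proj y = i := by
  simp [fibre]

theorem fibre_nonempty (i : X) : (F.fibre i).Nonempty :=
  (F.proj_surjective i).imp fun _ hy => F.mem_fibre.2 hy

theorem cartan_proj (y : Y) (j : X) : A (F.proj y) j = ∑ z ∈ F.fibre j, B y z := by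
  rw [F.σ_cartan _ j y ((F.σ_eq_iff _ y).2 rfl), finsum_eq_sum_of_fintype, fibre,
    Finset.sum_filter]
  refine Finset.sum_congr rfl fun z _ => ?_
  classical
  rw [finsum_eq_if]
  exact if_congr (F.σ_eq_iff j z) rfl rfl

/-- The linear map of root lattices which sends `α_y` to `αᵢ` for `y ∈ σ(i)`. -/
def foldMap : (Y → ℤ) →ₗ[ℤ] (X → ℤ) :=
  LinearMap.pi fun i => ∑ y ∈ F.fibre i, LinearMap.proj y

theorem foldMap_apply (v : Y → ℤ) (i : X) : F.foldMap v i = ∑ y ∈ F.fibre i, v y := by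
  simp [foldMap]

theorem foldMap_simpleRoot (y : Y) : F.foldMap (simpleRoot y) = simpleRoot (F.proj y) := by
  ext i
  simp [foldMap_apply, simpleRoot, Pi.single_apply, mem_fibre, eq_comm]

theorem foldMap_nonneg {v : Y → ℤ} (hv : 0 ≤ v) : 0 ≤ F.foldMap v := fun i => by
  rw [foldMap_apply]
  exact Finset.sum_nonneg fun y _ => hv y

theorem foldMap_nonpos {v : Y → ℤ} (hv : v ≤ 0) : F.foldMap v ≤ 0 := fun i => by
  rw [foldMap_apply]
  exact Finset.sum_nonpos fun y _ => hv y

theorem eq_zero_of_foldMap_eq_zero {v : Y → ℤ} (hv : 0 ≤ v) (h : F.foldMap v = 0) : v = 0 := by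
  ext y
  have := congrFun h (F.proj y)
  rw [foldMap_apply, Pi.zero_apply, Finset.sum_eq_zero_iff_of_nonneg fun y _ => hv y] at this
  exact this y (F.mem_fibre.2 rfl)

theorem sum_fibre {M : Type*} [AddCommMonoid M] (f : Y → M) :
    ∑ i, ∑ y ∈ F.fibre i, f y = ∑ y, f y :=
  Finset.sum_fiberwise Finset.univ F.proj f

theorem simpleCoroot_foldMap (j : X) (v : Y → ℤ) :
    simpleCoroot A j (F.foldMap v) = ∑ z ∈ F.fibre j, simpleCoroot B z v := by
  simp only [simpleCoroot_apply, foldMap_apply]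
  rw [Finset.sum_comm, ← F.sum_fibre]
  refine Finset.sum_congr rfl fun i _ => ?_
  rw [Finset.sum_mul]
  refine Finset.sum_congr rfl fun y hy => ?_
  rw [← F.mem_fibre.1 hy, F.cartan_proj y j, Finset.mul_sum]

/-! ### The root system and longest elements of the folded diagram. -/

section Datum

/-- The entry `A j j = 2` is the sum of `B y y = 2` and nonpositive terms over the orbit, so these
all vanish: nodes of one orbit are not joined. -/
theorem cartan_eq_zero (hB : IsFiniteSymmetric B) (hA : ∀ i, A i i = 2) {y z : Y}
    (hyz : F.proj y = F.proj z) (hne : y ≠ z) : B y z = 0 := by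
  have h1 := F.cartan_proj y (F.proj y)
  rw [hA, ← Finset.add_sum_erase _ _ (F.mem_fibre.2 rfl), hB.diag, left_eq_add,
    Finset.sum_eq_zero_iff_of_nonpos fun z hz => hB.nonpos y z (Finset.ne_of_mem_erase hz).symm] at h1
  exact h1 z (Finset.mem_erase.2 ⟨hne.symm, F.mem_fibre.2 hyz.symm⟩)

/-- Orthogonality inside an orbit makes the reflections subtract independent multiples of the roots.
The second clause, that coroots not yet used keep their values, drives the induction. -/
theorem wordProd_orbit (hB : IsFiniteSymmetric B) (hA : ∀ i, A i i = 2) (l : List Y)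
    (hl : l.Nodup) (j : X) (hj : ∀ y ∈ l, F.proj y = j) (v : Y → ℤ) :
    (l.map (simpleReflection B)).prod v = v - (l.map fun z => simpleCoroot B z v • simpleRoot z).sum ∧
    ∀ y, F.proj y = j → y ∉ l →
      simpleCoroot B y ((l.map (simpleReflection B)).prod v) = simpleCoroot B y v := by
  induction l with
  | nil => simp
  | cons z l ih =>
    obtain ⟨h1, h2⟩ := ih hl.of_cons fun y hy => hj y (List.mem_cons_of_mem z hy)
    have hz : F.proj z = j := hj z List.mem_cons_self
    simp only [List.map_cons, List.prod_cons, Module.End.mul_apply, List.sum_cons,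
      simpleReflection_apply, h2 z hz hl.notMem]
    refine ⟨by rw [h1]; abel, fun y hy hyl => ?_⟩
    rw [map_sub, map_smul, simpleCoroot_simpleRoot, h2 y hy fun h => hyl (List.mem_cons_of_mem z h),
      F.cartan_eq_zero hB hA (hz.trans hy.symm) (fun h => hyl (h ▸ List.mem_cons_self)), smul_zero,
      sub_zero]

theorem exists_lift_reflection (hB : IsFiniteSymmetric B) (hA : ∀ i, A i i = 2) {I : Set X} {j : X}
    (hj : j ∈ I) : ∃ w ∈ parabolic B (F.image I), ∀ v,
      F.foldMap (w v) = simpleReflection A j (F.foldMap v) := by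
  have hl : ∀ y ∈ (F.fibre j).toList, F.proj y = j := fun y hy =>
    F.mem_fibre.1 (Finset.mem_toList.1 hy)
  refine ⟨((F.fibre j).toList.map (simpleReflection B)).prod, mem_parabolic_iff.2 ⟨_, fun y hy =>
    F.mem_image.2 (by rwa [hl y hy]), rfl⟩, fun v => ?_⟩
  rw [(F.wordProd_orbit hB hA _ (Finset.nodup_toList _) j hl v).1, simpleReflection_apply,
    Finset.sum_map_toList, map_sub, map_sum, simpleCoroot_foldMap, Finset.sum_smul]
  congr 1
  refine Finset.sum_congr rfl fun z hz => ?_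
  rw [map_smul, foldMap_simpleRoot, F.mem_fibre.1 hz]

theorem exists_lift (hB : IsFiniteSymmetric B) (hA : ∀ i, A i i = 2) {I : Set X}
    {w : Module.End ℤ (X → ℤ)} (hw : w ∈ parabolic A I) :
    ∃ w' ∈ parabolic B (F.image I), ∀ v, F.foldMap (w' v) = w (F.foldMap v) := by
  induction hw using Submonoid.closure_induction_left with
  | one => exact ⟨1, one_mem _, fun _ => rfl⟩
  | mul_left x hx y _ ih =>
    obtain ⟨j, hj, rfl⟩ := hx
    obtain ⟨u, hu, huv⟩ := ih
    obtain ⟨r, hr, hrv⟩ := F.exists_lift_reflection hB hA hj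
    exact ⟨r * u, mul_mem hr hu, fun v => by
      rw [Module.End.mul_apply, Module.End.mul_apply, hrv, huv]⟩

/-- The symmetrizing weights of the folded diagram. -/
def weight (j : X) : ℤ := ∏ i ∈ Finset.univ.erase j, ((F.fibre i).card : ℤ)

/-- The weights are inversely proportional to the orbit sizes; taking the product of the other sizes
keeps them integral. -/
theorem card_mul_weight (j : X) :
    ((F.fibre j).card : ℤ) * F.weight j = ∏ i, ((F.fibre i).card : ℤ) :=
  Finset.mul_prod_erase Finset.univ (fun i => ((F.fibre i).card : ℤ)) (Finset.mem_univ j)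

theorem card_fibre_pos (j : X) : 0 < ((F.fibre j).card : ℤ) :=
  Int.natCast_pos.2 (F.fibre_nonempty j).card_pos

theorem isSymmetrizable (hB : IsFiniteSymmetric B) (hA : ∀ i, A i i = 2) :
    IsSymmetrizable A F.weight where
  diag := hA
  pos j := Finset.prod_pos fun i _ => F.card_fibre_pos i
  symm i j := by
    -- Summing `B` over a product of two orbits gives the orbit size times the folded entry;
    -- symmetry of `B` then symmetrizes these.
    have key : ∀ i j, ((F.fibre i).card : ℤ) * A i j =
        ∑ y ∈ F.fibre i, ∑ z ∈ F.fibre j, B y z := by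
      intro i j
      rw [← nsmul_eq_mul, ← Finset.sum_const]
      refine Finset.sum_congr rfl fun y hy => ?_
      rw [← F.cartan_proj y j, F.mem_fibre.1 hy]
    have hs : ((F.fibre i).card : ℤ) * A i j = ((F.fibre j).card : ℤ) * A j i :=
      (key i j).trans (Finset.sum_comm.trans ((Finset.sum_congr rfl fun z _ =>
        Finset.sum_congr rfl fun y _ => hB.symm y z).trans (key j i).symm))
    refine mul_left_cancel₀ (mul_pos (F.card_fibre_pos i) (F.card_fibre_pos j)).ne' ?_
    have h1 := F.card_mul_weight i
    have h2 := F.card_mul_weight j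
    linear_combination ((F.fibre j).card * F.weight j : ℤ) * hs +
      ((F.fibre j).card * A j i : ℤ) * h2 - ((F.fibre j).card * A j i : ℤ) * h1

/-- Such a `v` is supported on one orbit, where the form is twice the sum of squares. Norm `2` makes
the sum of squares `1`, and a nonnegative integer is at most its square. -/
theorem foldMap_le_one (hB : IsFiniteSymmetric B) (hA : ∀ i, A i i = 2) {v : Y → ℤ}
    (hv : v ∈ shortVectors B) (h0 : 0 ≤ v) {i : X} (hi : ∀ j, j ≠ i → F.foldMap v j = 0) :
    F.foldMap v i ≤ 1 := by
  have hoff : ∀ y, F.proj y ≠ i → v y = 0 := fun y hy => by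
    have := hi _ hy
    rw [foldMap_apply, Finset.sum_eq_zero_iff_of_nonneg fun y _ => h0 y] at this
    exact this y (F.mem_fibre.2 rfl)
  have hform : form B 1 v v = 2 * ∑ y ∈ F.fibre i, v y * v y := by
    have hsub : ∀ f : Y → ℤ, (∀ y, v y = 0 → f y = 0) → ∑ y, f y = ∑ y ∈ F.fibre i, f y :=
      fun f hf => (Finset.sum_subset (Finset.subset_univ _) fun y _ hy =>
        hf y (hoff y fun h => hy (F.mem_fibre.2 h))).symm
    rw [form_apply, hsub _ fun y hy => by rw [hy, mul_zero, mul_zero], Finset.mul_sum]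
    refine Finset.sum_congr rfl fun z hz => ?_
    rw [simpleCoroot_apply, hsub _ fun y hy => by rw [hy, zero_mul],
      Finset.sum_eq_single_of_mem z hz, hB.diag, Pi.one_apply]
    · ring
    · intro y hy hne
      rw [F.cartan_eq_zero hB hA ((F.mem_fibre.1 hy).trans (F.mem_fibre.1 hz).symm) hne, mul_zero]
  have h2 : form B 1 v v = 2 := hv
  have hle : F.foldMap v i ≤ ∑ y ∈ F.fibre i, v y * v y := by
    rw [foldMap_apply]
    refine Finset.sum_le_sum fun y _ => ?_
    rcases (h0 y : (0 : ℤ) ≤ v y).eq_or_lt with h | h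
    · have h' : v y = 0 := h.symm
      rw [h', mul_zero]
    · exact le_mul_of_one_le_left h.le h
  omega

theorem isRootDatum (hB : IsFiniteSymmetric B) (hA : ∀ i, A i i = 2) :
    IsRootDatum A F.weight (F.foldMap '' shortVectors B) where
  toIsSymmetrizable := F.isSymmetrizable hB hA
  finite := hB.shortVectors_finite.image _
  simple i := by
    obtain ⟨y, rfl⟩ := F.proj_surjective i
    exact ⟨simpleRoot y, hB.isRootDatum.simple y, F.foldMap_simpleRoot y⟩
  refl i := by
    rintro _ ⟨v, hv, rfl⟩
    obtain ⟨w, hw, hwv⟩ := F.exists_lift_reflection hB hA (Set.mem_univ i)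
    exact ⟨w v, hB.isRootDatum.apply_mem hw hv, hwv v⟩
  ne_zero := by
    rintro _ ⟨v, hv, rfl⟩ hz
    rcases hB.isRootDatum.sign v hv with h0 | h0
    · exact hB.isRootDatum.ne_zero v hv (F.eq_zero_of_foldMap_eq_zero h0 hz)
    · refine hB.isRootDatum.ne_zero v hv (neg_eq_zero.1 ?_)
      exact F.eq_zero_of_foldMap_eq_zero (neg_nonneg.2 h0) (by rw [map_neg, hz, neg_zero])
  sign := by
    rintro _ ⟨v, hv, rfl⟩
    exact (hB.isRootDatum.sign v hv).imp F.foldMap_nonneg F.foldMap_nonpos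
  reduced := by
    rintro _ ⟨v, hv, rfl⟩ i hi
    rcases hB.isRootDatum.sign v hv with h0 | h0
    · exact F.foldMap_le_one hB hA hv h0 hi
    · exact (F.foldMap_nonpos h0 i).trans zero_le_one

/-- Lift `w₀^I` to an element of `W^{σ(I)}`. The folded image of a simple root of `σ(I)` under the
lift is nonpositive, while a positive root never folds to a nonpositive vector. So the lift negates
these simple roots and is the longest element. -/
theorem foldMap_longest (hB : IsFiniteSymmetric B) (hA : ∀ i, A i i = 2) (I : Set X) (v : Y → ℤ) :
    F.foldMap (longest B (F.image I) v) = longest A I (F.foldMap v) := by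
  obtain ⟨w, hw, hwv⟩ := F.exists_lift hB hA ((F.isRootDatum hB hA).longest_mem I)
  have hneg : NegatesSimple B (F.image I) w := by
    refine ⟨hw, fun y hy => ?_⟩
    have hroot := hB.isRootDatum.apply_mem hw (hB.isRootDatum.simple y)
    refine (hB.isRootDatum.sign _ hroot).resolve_left fun h0 => hB.isRootDatum.ne_zero _ hroot ?_
    refine F.eq_zero_of_foldMap_eq_zero h0 (le_antisymm ?_ (F.foldMap_nonneg h0))
    rw [hwv, foldMap_simpleRoot]
    exact ((F.isRootDatum hB hA).longest_spec I).2 _ (F.mem_image.1 hy)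
  rw [← hB.isRootDatum.eq_longest hneg, hwv]

theorem proj_opp (hB : IsFiniteSymmetric B) (hA : ∀ i, A i i = 2) {I : Set X} {y : Y}
    (hy : y ∈ F.image I) : F.proj (opp B (F.image I) y) = opp A I (F.proj y) := by
  have h := F.foldMap_longest hB hA I (simpleRoot y)
  rw [hB.isRootDatum.longest_simpleRoot hy, map_neg, foldMap_simpleRoot, foldMap_simpleRoot] at h
  exact (((F.isRootDatum hB hA).opp_eq_iff (F.mem_image.1 hy)).2 h.symm).symm

theorem opp_image (hB : IsFiniteSymmetric B) (hA : ∀ i, A i i = 2) {I J : Set X} (hJ : J ⊆ I) :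
    opp B (F.image I) '' F.image J = F.image (opp A I '' J) := by
  ext y
  constructor
  · rintro ⟨y, hy, rfl⟩
    rw [mem_image, F.proj_opp hB hA (F.image_mono hJ hy)]
    exact ⟨_, F.mem_image.1 hy, rfl⟩
  · intro hy
    obtain ⟨j, hj, hjy⟩ := F.mem_image.1 hy
    have hyI : y ∈ F.image I := F.mem_image.2 (by
      rw [← hjy]
      exact (F.isRootDatum hB hA).opp_mem (hJ hj))
    refine ⟨opp B (F.image I) y, ?_, hB.isRootDatum.opp_opp hyI⟩
    rw [mem_image, F.proj_opp hB hA hyI, ← hjy, (F.isRootDatum hB hA).opp_opp (hJ hj)]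
    exact hj

end Datum

end Folding

/-! ### Relations in cactus groups -/

section Cactus

variable {ι : Type*} [Fintype ι] [DecidableEq ι]
  {A : Matrix ι ι ℤ} {d : ι → ℤ} {Φ : Set (ι → ℤ)}

theorem gen_mul_self (I : ConnSub A) : gen I * gen I = 1 :=
  PresentedGroup.one_of_mem (CactusRel.sq I)

theorem pairwise_commute_gen (A : Matrix ι ι ℤ) (S : Set ι) :
    ((components A S : Finset (ConnSub A)) : Set (ConnSub A)).Pairwise
      (Function.onFun Commute gen) :=
  fun _ hC _ hD hne => gen_comm _ _ (not_isConn_union hC hD hne)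

/-- The product of the commuting generators which belong to the connected components of `S`. -/
def setGen (A : Matrix ι ι ℤ) (S : Set ι) : CactusGroup A :=
  (components A S).noncommProd gen (pairwise_commute_gen A S)

theorem setGen_eq_prod {S : Set ι} (l : List (ConnSub A)) (hl : l.Nodup)
    (hmem : ∀ C, C ∈ l ↔ C ∈ components A S) : setGen A S = (l.map gen).prod := by
  classical
  have hS : components A S = l.toFinset := by
    ext C
    rw [List.mem_toFinset, hmem]
  have key : ∀ (s : Finset (ConnSub A)) (hs) (_ : s = l.toFinset),
      s.noncommProd gen hs = (l.map gen).prod := by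
    rintro s hs rfl
    exact Finset.noncommProd_toFinset l gen hs hl
  exact key _ _ hS

theorem setGen_eq_prod_toList (S : Set ι) :
    setGen A S = ((components A S).toList.map gen).prod :=
  setGen_eq_prod _ (Finset.nodup_toList _) fun _ => Finset.mem_toList

theorem setGen_mul_self (S : Set ι) : setGen A S * setGen A S = 1 := by
  have hc := pairwise_commute_gen A S
  refine (Finset.noncommProd_mul_distrib gen gen hc hc hc).symm.trans ?_
  exact (Finset.noncommProd_eq_pow_card _ _ _ 1 fun C _ => gen_mul_self C).trans (one_pow _)

theorem commute_setGen {S : Set ι} {x : CactusGroup A}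
    (hx : ∀ C ∈ components A S, Commute x (gen C)) : Commute x (setGen A S) :=
  Finset.noncommProd_commute _ _ _ _ hx

namespace IsRootDatum

theorem commute_gen (h : IsRootDatum A d Φ) {I J : ConnSub A} (hO : Orth A I.1 J.1) :
    Commute (gen I) (gen J) :=
  gen_comm I J ((h.not_isConn_union_iff I.2 J.2).2 hO)

theorem gen_mul_gen (h : IsRootDatum A d Φ) {I J : ConnSub A} (hJ : J.1 ⊆ I.1) :
    gen I * gen J = gen (h.oppSub I.1 J hJ) * gen I :=
  mul_inv_eq_one.mp (PresentedGroup.one_of_mem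
    (CactusRel.conj I J (h.oppSub I.1 J hJ) hJ ((h.isThetaImage_iff hJ).2 rfl)))

theorem setGen_comm (h : IsRootDatum A d Φ) {S T : Set ι} (hO : Orth A S T) :
    Commute (setGen A S) (setGen A T) :=
  commute_setGen fun _ hD => (commute_setGen fun _ hC => (h.commute_gen fun i hi j hj =>
    hO i (subset_of_mem_components hC hi) j (subset_of_mem_components hD hj)).symm).symm

/-- Only the factor of the component containing `D` moves `D`; the other factors belong to
orthogonal components and commute with `gen D`. -/
theorem setGen_mul_gen (h : IsRootDatum A d Φ) {S : Set ι} {D : ConnSub A} (hD : D.1 ⊆ S) :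
    setGen A S * gen D = gen (h.oppSub S D hD) * setGen A S := by
  classical
  obtain ⟨C, hC, hDC⟩ := exists_component D hD
  have hS : h.oppSub S D hD = h.oppSub C.1 D hDC := Subtype.ext (h.opp_image_component hC hDC)
  have hcomm := pairwise_commute_gen A S
  have hprod : setGen A S = gen C * ((components A S).erase C).noncommProd gen
      (hcomm.mono (by simp)) :=
    (Finset.mul_noncommProd_erase _ hC gen hcomm _).symm
  have hrest : Commute (gen D) (((components A S).erase C).noncommProd gen
      (hcomm.mono (by simp))) := by
    refine Finset.noncommProd_commute _ _ _ _ fun E hE => h.commute_gen fun i hi j hj => ?_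
    exact h.orth_components hC (Finset.mem_of_mem_erase hE) (Finset.ne_of_mem_erase hE).symm i
      (hDC hi) j hj
  rw [hprod, hS, mul_assoc, ← hrest.eq, ← mul_assoc, h.gen_mul_gen hDC, mul_assoc]

/-- `θ_S` is an involution on subsets of `S` and carries the components of `T` bijectively to those
of `θ_S(T)`, so the left factor can be moved past one component at a time. -/
theorem setGen_mul_setGen (h : IsRootDatum A d Φ) {S T : Set ι} (hT : T ⊆ S) :
    setGen A S * setGen A T = setGen A (opp A S '' T) * setGen A S := by
  classical
  -- The value off subsets of `S` is a default; `f` is evaluated only on subdiagrams contained in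
  -- `S`.
  let f : ConnSub A → ConnSub A := fun D => if hD : D.1 ⊆ S then h.oppSub S D hD else D
  have hf : ∀ D (hD : D.1 ⊆ S), f D = h.oppSub S D hD := fun D hD => dif_pos hD
  have hff : ∀ D : ConnSub A, D.1 ⊆ S → f (f D) = D := fun D hD => by
    rw [hf D hD, hf _ (h.opp_image_subset hD)]
    exact Subtype.ext (h.opp_image_opp_image hD)
  have hsub : ∀ D ∈ components A T, D.1 ⊆ S := fun D hD => (subset_of_mem_components hD).trans hT
  have hmem : ∀ U ⊆ S, ∀ D ∈ components A U, f D ∈ components A (opp A S '' U) := by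
    intro U hU D hD
    rw [hf D ((subset_of_mem_components hD).trans hU)]
    exact h.oppSub_mem_components hU hD
  rw [setGen_eq_prod_toList T, setGen_eq_prod (S := opp A S '' T) ((components A T).toList.map f)]
  · have : ∀ l : List (ConnSub A), (∀ D ∈ l, D.1 ⊆ S) →
        setGen A S * (l.map gen).prod = ((l.map f).map gen).prod * setGen A S := by
      intro l hl
      induction l with
      | nil => simp
      | cons D l ih =>
        have hD := hl D List.mem_cons_self
        simp only [List.map_cons, List.prod_cons]
        rw [← mul_assoc, h.setGen_mul_gen hD, mul_assoc,
          ih fun E hE => hl E (List.mem_cons_of_mem D hE), ← mul_assoc, hf D hD]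
    exact this _ fun D hD => hsub D (Finset.mem_toList.1 hD)
  · refine List.Nodup.map_on (fun D hD E hE hDE => ?_) (Finset.nodup_toList _)
    rw [← hff D (hsub D (Finset.mem_toList.1 hD)), hDE, hff E (hsub E (Finset.mem_toList.1 hE))]
  · intro D
    simp only [List.mem_map, Finset.mem_toList]
    constructor
    · rintro ⟨E, hE, rfl⟩
      exact hmem T hT E hE
    · intro hD
      refine ⟨f D, ?_, hff D ((subset_of_mem_components hD).trans (h.opp_image_subset hT))⟩
      have := hmem _ (h.opp_image_subset hT) D hD
      rwa [h.opp_image_opp_image hT] at this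

end IsRootDatum

end Cactus

/-! ### The homomorphism of cactus groups given by a folding. -/

namespace Folding

variable {X Y : Type*} [Fintype X] [DecidableEq X] [Fintype Y] [DecidableEq Y]
  {A : Matrix X X ℤ} {B : Matrix Y Y ℤ} (F : Folding A B)

theorem sTilde_eq_setGen (I : ConnSub A) : F.sTilde I = setGen B (F.image I.1) := rfl

/-- A folded entry is a sum over an orbit of off-diagonal, hence nonpositive, entries; if it
vanishes, so does each term. -/
theorem orth_image (hB : IsFiniteSymmetric B) (hA : ∀ i, A i i = 2) {I J : Set X}
    (hO : Orth A I J) : Orth B (F.image I) (F.image J) := by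
  intro y hy z hz
  have hi := F.mem_image.1 hy
  have hj := F.mem_image.1 hz
  have hsum := (F.cartan_proj y (F.proj z)).symm.trans (hO _ hi _ hj)
  rw [Finset.sum_eq_zero_iff_of_nonpos] at hsum
  · exact hsum z (F.mem_fibre.2 rfl)
  · intro x hx
    refine hB.nonpos y x ?_
    rintro rfl
    rw [F.mem_fibre.1 hx] at hi
    exact (F.isRootDatum hB hA).not_orth_of_mem hi hj hO

theorem lift_sTilde_eq_one (hB : IsFiniteSymmetric B) (hA : ∀ i, A i i = 2) :
    ∀ r ∈ {r | CactusRel A r}, FreeGroup.lift F.sTilde r = 1 := by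
  have hX := F.isRootDatum hB hA
  have hY := hB.isRootDatum
  rintro _ (I | ⟨I, J, hIJ⟩ | ⟨I, J, K, hJ, hK⟩)
  · simp only [map_mul, FreeGroup.lift_apply_of, sTilde_eq_setGen]
    exact setGen_mul_self _
  · simp only [map_mul, map_inv, FreeGroup.lift_apply_of, sTilde_eq_setGen, mul_inv_eq_one]
    exact hY.setGen_comm (F.orth_image hB hA ((hX.not_isConn_union_iff I.2 J.2).1 hIJ))
  · simp only [map_mul, map_inv, FreeGroup.lift_apply_of, sTilde_eq_setGen, mul_inv_eq_one]
    rw [(hX.isThetaImage_iff hJ).1 hK, ← F.opp_image hB hA hJ]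
    exact hY.setGen_mul_setGen (F.image_mono hJ)

/-- The homomorphism `Φ : J_X → J_Y` with `Φ(s_I) = s̃_I`. -/
def cactusHom (hB : IsFiniteSymmetric B) (hA : ∀ i, A i i = 2) : CactusGroup A →* CactusGroup B :=
  PresentedGroup.toGroup (F.lift_sTilde_eq_one hB hA)

theorem cactusHom_gen (hB : IsFiniteSymmetric B) (hA : ∀ i, A i i = 2) (I : ConnSub A) :
    F.cactusHom hB hA (gen I) = F.sTilde I :=
  PresentedGroup.toGroup.of _

end Folding

/-! ### The action of a cactus group on reduced words of parabolics -/

section Letters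

variable {V : Type*} {c : V → V → Prop}

theorem reduced_nil : Reduced c [] := trivial

theorem Cancels.of_append {p : V} {u w : List V} (h : Cancels c p (u ++ w)) :
    p ∈ u ∨ ((∀ x ∈ u, c p x) ∧ Cancels c p w) := by
  induction u with
  | nil => exact Or.inr ⟨by simp, h⟩
  | cons x u ih =>
    rcases h with rfl | ⟨h1, h2⟩
    · exact Or.inl List.mem_cons_self
    · rcases ih h2 with hp | ⟨hu, hw⟩
      · exact Or.inl (List.mem_cons_of_mem x hp)
      · exact Or.inr ⟨List.forall_mem_cons.2 ⟨h1, hu⟩, hw⟩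

/-- Prepending distinct letters never erases any: a cancellation would have to meet an equal letter
of `u`, or one of `w` after passing through `u`. -/
theorem Trace.prod_actPerm_mk (hs : ∀ ⦃p q⦄, c p q → c q p) {u w : List V} (hu : u.Nodup)
    (hw : Reduced c w) (huw : ∀ p ∈ u, ¬ Cancels c p w) :
    ∃ h : Reduced c (u ++ w), (u.map (Trace.actPerm hs)).prod (Trace.mk w hw) =
      Trace.mk (u ++ w) h := by
  induction u with
  | nil => exact ⟨hw, rfl⟩
  | cons x u ih =>
    obtain ⟨hr, he⟩ := ih hu.of_cons fun p hp => huw p (List.mem_cons_of_mem x hp)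
    have hx : ¬ Cancels c x (u ++ w) := fun h =>
      h.of_append.elim hu.notMem fun h' => huw x List.mem_cons_self h'.2
    refine ⟨⟨hx, hr⟩, ?_⟩
    rw [List.map_cons, List.prod_cons, Equiv.Perm.mul_apply, he]
    refine Trace.mk_eq_mk.2 ?_
    rw [wordAct_of_not_cancels hx]
    exact TraceEquiv.refl _

end Letters

section Action

variable {ι : Type*} [Fintype ι] [DecidableEq ι]
  {A : Matrix ι ι ℤ} {d : ι → ℤ} {Φ : Set (ι → ℤ)}

/-- Two sets of vectors are nested or orthogonal. -/
def NestedOrOrth (A : Matrix ι ι ℤ) (d : ι → ℤ) (P Q : Set (ι → ℤ)) : Prop :=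
  P ⊆ Q ∨ Q ⊆ P ∨ ∀ u ∈ P, ∀ v ∈ Q, form A d u v = 0

theorem NegatesSimple.one : NegatesSimple A ∅ 1 :=
  ⟨one_mem _, fun _ hi => hi.elim⟩

namespace IsRootDatum

theorem nestedOrOrth_symm (h : IsRootDatum A d Φ) ⦃P Q : Set (ι → ℤ)⦄
    (hPQ : NestedOrOrth A d P Q) : NestedOrOrth A d Q P := by
  rcases hPQ with h1 | h1 | h1
  · exact Or.inr (Or.inl h1)
  · exact Or.inl h1
  · exact Or.inr (Or.inr fun v hv u hu => by rw [h.form_comm, h1 u hu v hv])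

theorem nestedOrOrth_coordSpan (h : IsRootDatum A d Φ) {C D : Set ι} :
    NestedOrOrth A d (coordSpan C) (coordSpan D) ↔ C ⊆ D ∨ D ⊆ C ∨ Orth A C D := by
  refine or_congr coordSpan_subset_iff (or_congr coordSpan_subset_iff ⟨fun hO i hi j hj => ?_, ?_⟩)
  · have := hO _ (simpleRoot_mem_coordSpan.2 hi) _ (simpleRoot_mem_coordSpan.2 hj)
    rw [form_simpleRoot_right, simpleCoroot_simpleRoot, mul_eq_zero] at this
    exact this.resolve_left (h.pos j).ne'
  · intro hO u hu v hv
    rw [form_apply]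
    refine Finset.sum_eq_zero fun j _ => ?_
    by_cases hj : j ∈ D
    · have : simpleCoroot A j u = 0 := by
        rw [simpleCoroot_apply]
        refine Finset.sum_eq_zero fun i _ => ?_
        by_cases hi : i ∈ C
        · rw [hO i hi j hj, mul_zero]
        · rw [hu i hi, zero_mul]
      rw [this, zero_mul, mul_zero]
    · rw [hv j hj, mul_zero, mul_zero]

theorem longest_empty (h : IsRootDatum A d Φ) : longest A ∅ = 1 :=
  (h.eq_longest NegatesSimple.one).symm

/-- The longest element of `W^I`, as a permutation of the root lattice. -/
def longestEquiv (h : IsRootDatum A d Φ) (I : Set ι) : Equiv.Perm (ι → ℤ) :=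
  Function.Involutive.toPerm (longest A I) (h.longest_longest I)

/-- The longest element of `W^I`, as a permutation of the sets of vectors. -/
def letterPerm (h : IsRootDatum A d Φ) (I : Set ι) : commPerms (NestedOrOrth A d) :=
  ⟨Equiv.Set.congr (h.longestEquiv I), fun P Q => by
    have hinj : Function.Injective (h.longestEquiv I) := (h.longestEquiv I).injective
    simp only [NestedOrOrth, Equiv.Set.congr_apply, Set.image_subset_image_iff hinj,
      Set.forall_mem_image]
    refine or_congr_right (or_congr_right ?_)
    exact forall₂_congr fun u _ => forall₂_congr fun v _ => by
      rw [show form A d (h.longestEquiv I u) (h.longestEquiv I v) = form A d u v from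
        h.form_apply_apply (h.longest_mem I) u v]⟩

theorem letterPerm_apply (h : IsRootDatum A d Φ) (I : Set ι) (P : Set (ι → ℤ)) :
    (h.letterPerm I).1 P = longest A I '' P := rfl

theorem letterPerm_mul_apply (h : IsRootDatum A d Φ) (I J : Set ι) (P : Set (ι → ℤ)) :
    (h.letterPerm I * h.letterPerm J).1 P = (longest A I * longest A J) '' P := by
  rw [Subgroup.coe_mul, Equiv.Perm.mul_apply, letterPerm_apply, letterPerm_apply, Set.image_image]
  rfl

theorem letterPerm_mul_letterPerm (h : IsRootDatum A d Φ) {I J K L : Set ι}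
    (heq : longest A I * longest A J = longest A K * longest A L) :
    h.letterPerm I * h.letterPerm J = h.letterPerm K * h.letterPerm L :=
  Subtype.ext (Equiv.ext fun P => by rw [letterPerm_mul_apply, letterPerm_mul_apply, heq])

theorem letterPerm_empty (h : IsRootDatum A d Φ) : h.letterPerm ∅ = 1 :=
  Subtype.ext (Equiv.ext fun P => by
    rw [letterPerm_apply, h.longest_empty]
    exact Set.image_id P)

theorem letterPerm_mul_self (h : IsRootDatum A d Φ) (I : Set ι) :
    h.letterPerm I * h.letterPerm I = 1 :=
  Subtype.ext (Equiv.ext fun P => by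
    rw [letterPerm_mul_apply, h.longest_mul_self]
    exact Set.image_id P)

theorem letterPerm_union (h : IsRootDatum A d Φ) {C D : Set ι} (hO : Orth A C D) :
    h.letterPerm (C ∪ D) = h.letterPerm C * h.letterPerm D :=
  Subtype.ext (Equiv.ext fun P => by
    rw [letterPerm_mul_apply, letterPerm_apply, h.longest_union hO])

theorem letterPerm_coordSpan (h : IsRootDatum A d Φ) {I J : Set ι} (hJ : J ⊆ I) :
    (h.letterPerm I).1 (coordSpan J) = coordSpan (opp A I '' J) :=
  h.longest_image_coordSpan hJ

theorem letterPerm_coordSpan_of_orth (h : IsRootDatum A d Φ) {C D : Set ι} (hO : Orth A C D) :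
    (h.letterPerm D).1 (coordSpan C) = coordSpan C :=
  (Set.image_congr fun _ hv => hO.apply_eq_self (h.longest_mem D) hv).trans (Set.image_id' _)

/-- If `C` is a union of components of `S`, then `W^S` stabilizes the span of `C`. -/
theorem letterPerm_coordSpan_of_subset (h : IsRootDatum A d Φ) {S C D : Set ι}
    (hO : Orth A C (S \ C)) (hD : D ⊆ S) : (h.letterPerm D).1 (coordSpan C) = coordSpan C := by
  have key : ∀ w ∈ parabolic A D, ∀ v ∈ coordSpan C, w v ∈ coordSpan C := by
    intro w hw v hv
    induction hw using Submonoid.closure_induction_left with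
    | one => exact hv
    | mul_left x hx y _ ih =>
      obtain ⟨i, hi, rfl⟩ := hx
      by_cases hiC : i ∈ C
      · intro k hk
        rw [Module.End.mul_apply, simpleReflection_apply_of_ne A (fun e => hk (by rwa [e])),
          ih k hk]
      · have : simpleReflection A i (y v) = y v :=
          hO.apply_eq_self (simpleReflection_mem_parabolic A ⟨hD hi, hiC⟩) ih
        rwa [Module.End.mul_apply, this]
  refine Set.Subset.antisymm ?_ fun v hv =>
    ⟨longest A D v, key _ (h.longest_mem D) v hv, h.longest_longest D v⟩
  rintro _ ⟨v, hv, rfl⟩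
  exact key _ (h.longest_mem D) v hv

/-- The action of a generator of the cactus group on classes of reduced words. -/
def genPerm (h : IsRootDatum A d Φ) (I : ConnSub A) : Equiv.Perm (Trace (NestedOrOrth A d)) :=
  Trace.actPerm h.nestedOrOrth_symm (coordSpan I.1) *
    Trace.mapPerm (NestedOrOrth A d) (h.letterPerm I.1)

/-- The product is normalised as in a semidirect product, letters to the left: `w₀^I` moves the
letter of `J`. -/
theorem genPerm_mul_genPerm (h : IsRootDatum A d Φ) (I J : ConnSub A) :
    h.genPerm I * h.genPerm J =
      Trace.actPerm h.nestedOrOrth_symm (coordSpan I.1) *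
        Trace.actPerm h.nestedOrOrth_symm ((h.letterPerm I.1).1 (coordSpan J.1)) *
        Trace.mapPerm (NestedOrOrth A d) (h.letterPerm I.1 * h.letterPerm J.1) := by
  rw [genPerm, genPerm, mul_assoc, ← mul_assoc (Trace.mapPerm _ _), Trace.mapPerm_mul_actPerm,
    map_mul]
  simp only [mul_assoc]

/-- For each relation both letters and permutations agree. `w₀^I` fixes the letter of `I`; for
orthogonal `I`, `J` each longest element fixes the other letter; for `J ⊆ I` the letter of `J` moves
to that of `θ_I(J)`, which commutes with the larger letter of `I`. -/
theorem lift_genPerm_eq_one (h : IsRootDatum A d Φ) :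
    ∀ r ∈ {r | CactusRel A r}, FreeGroup.lift h.genPerm r = 1 := by
  rintro _ (I | ⟨I, J, hIJ⟩ | ⟨I, J, K, hJ, hK⟩)
  · rw [map_mul, FreeGroup.lift_apply_of, genPerm_mul_genPerm, h.letterPerm_mul_self,
      h.letterPerm_coordSpan subset_rfl, h.opp_image_self, Trace.actPerm_mul_self, map_one, one_mul]
  · have hO := (h.not_isConn_union_iff I.2 J.2).1 hIJ
    rw [map_mul, map_inv, map_mul, map_mul, FreeGroup.lift_apply_of, FreeGroup.lift_apply_of,
      mul_inv_eq_one, genPerm_mul_genPerm, genPerm_mul_genPerm, h.letterPerm_coordSpan_of_orth hO,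
      h.letterPerm_coordSpan_of_orth (h.orth_symm hO),
      h.letterPerm_mul_letterPerm (h.longest_comm hO).eq,
      (Trace.actPerm_comm _ (h.nestedOrOrth_coordSpan.2 (Or.inr (Or.inr hO)))).eq]
  · have hK' := (h.isThetaImage_iff hJ).1 hK
    have hKI : K.1 ⊆ I.1 := hK' ▸ h.opp_image_subset hJ
    rw [map_mul, map_inv, map_mul, map_mul, FreeGroup.lift_apply_of, FreeGroup.lift_apply_of,
      FreeGroup.lift_apply_of, mul_inv_eq_one, genPerm_mul_genPerm, genPerm_mul_genPerm,
      h.letterPerm_coordSpan hJ, ← hK', h.letterPerm_coordSpan_of_subset (S := I.1)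
        (fun i _ j hj => absurd (hj.1) hj.2) hKI,
      h.letterPerm_mul_letterPerm ((h.longest_mul_longest hJ).trans (by rw [← hK'])),
      (Trace.actPerm_comm _ (h.nestedOrOrth_coordSpan.2 (Or.inr (Or.inl hKI)))).eq]

/-- The action of the cactus group on classes of reduced words. -/
def cactusAction (h : IsRootDatum A d Φ) :
    CactusGroup A →* Equiv.Perm (Trace (NestedOrOrth A d)) :=
  PresentedGroup.toGroup h.lift_genPerm_eq_one

theorem cactusAction_gen (h : IsRootDatum A d Φ) (I : ConnSub A) :
    h.cactusAction (gen I) = h.genPerm I :=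
  PresentedGroup.toGroup.of _

/-- For pairwise orthogonal subdiagrams the permutations fix all the letters they have to pass, so
they collect on the right into one longest element. -/
theorem cactusAction_prod (h : IsRootDatum A d Φ) (l : List (ConnSub A))
    (hl : l.Pairwise fun C D => Orth A C.1 D.1) :
    h.cactusAction (l.map gen).prod =
      (l.map fun C => Trace.actPerm h.nestedOrOrth_symm (coordSpan C.1)).prod *
        Trace.mapPerm (NestedOrOrth A d) (h.letterPerm {i | ∃ C ∈ l, i ∈ C.1}) := by
  induction l with
  | nil => simp [h.letterPerm_empty]
  | cons C l ih =>
    obtain ⟨hC, hl⟩ := List.pairwise_cons.1 hl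
    have hU : {i | ∃ D ∈ C :: l, i ∈ D.1} = C.1 ∪ {i | ∃ D ∈ l, i ∈ D.1} := by
      ext i
      simp
    have hO : Orth A C.1 {i | ∃ D ∈ l, i ∈ D.1} := by
      rintro i hi j ⟨D, hD, hj⟩
      exact hC D hD i hi j hj
    have hcomm : ∀ l' ⊆ l, Trace.mapPerm (NestedOrOrth A d) (h.letterPerm C.1) *
          (l'.map fun C => Trace.actPerm h.nestedOrOrth_symm (coordSpan C.1)).prod =
        (l'.map fun C => Trace.actPerm h.nestedOrOrth_symm (coordSpan C.1)).prod *
          Trace.mapPerm (NestedOrOrth A d) (h.letterPerm C.1) := by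
      intro l' hl'
      induction l' with
      | nil => simp
      | cons D l' ih' =>
        have hD : D ∈ l := hl' List.mem_cons_self
        rw [List.map_cons, List.prod_cons, ← mul_assoc, Trace.mapPerm_mul_actPerm,
          h.letterPerm_coordSpan_of_orth (h.orth_symm (hC D hD)), mul_assoc,
          ih' fun E hE => hl' (List.mem_cons_of_mem D hE), mul_assoc]
    rw [List.map_cons, List.prod_cons, map_mul, ih hl, cactusAction_gen, genPerm, hU,
      h.letterPerm_union hO, map_mul, List.map_cons, List.prod_cons]
    simp only [mul_assoc]
    rw [← mul_assoc (Trace.mapPerm _ (h.letterPerm C.1)), hcomm l (List.Subset.refl l), mul_assoc]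

theorem cactusAction_setGen (h : IsRootDatum A d Φ) (S : Set ι) :
    h.cactusAction (setGen A S) =
      (((components A S).toList.map fun C => coordSpan C.1).map
        (Trace.actPerm h.nestedOrOrth_symm)).prod *
        Trace.mapPerm (NestedOrOrth A d) (h.letterPerm S) := by
  have hS : {i | ∃ C ∈ (components A S).toList, i ∈ C.1} = S := by
    ext i
    constructor
    · rintro ⟨C, hC, hi⟩
      exact subset_of_mem_components (Finset.mem_toList.1 hC) hi
    · intro hi
      obtain ⟨C, hC, hiC⟩ := h.exists_mem_component hi
      exact ⟨C, Finset.mem_toList.2 hC, hiC⟩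
  rw [setGen_eq_prod_toList, h.cactusAction_prod, hS, List.map_map]
  · rfl
  · refine (Finset.nodup_toList (components A S)).imp_of_mem fun hC hD hne => ?_
    exact h.orth_components (Finset.mem_toList.1 hC) (Finset.mem_toList.1 hD) hne

end IsRootDatum

theorem exists_word (g : CactusGroup A) : ∃ l : List (ConnSub A), (l.map gen).prod = g := by
  have hg : g ∈ Subgroup.closure (Set.range (PresentedGroup.of (rels := {r | CactusRel A r}))) := by
    rw [PresentedGroup.closure_range_of]
    trivial
  induction hg using Subgroup.closure_induction with
  | mem x hx =>
    obtain ⟨I, rfl⟩ := hx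
    exact ⟨[I], by simp [gen]⟩
  | one => exact ⟨[], rfl⟩
  | mul x y _ _ hx hy =>
    obtain ⟨l, rfl⟩ := hx
    obtain ⟨l', rfl⟩ := hy
    exact ⟨l ++ l', by simp⟩
  | inv x _ hx =>
    obtain ⟨l, rfl⟩ := hx
    refine ⟨l.reverse, ?_⟩
    rw [List.prod_inv_reverse, List.map_map, ← List.map_reverse]
    congr 1
    exact List.map_congr_left fun I _ => eq_inv_of_mul_eq_one_left (gen_mul_self I)

end Action

/-! ### Unfolding words and injectivity. -/

namespace Folding

variable {X Y : Type*} [Fintype X] [DecidableEq X] [Fintype Y] [DecidableEq Y]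
  {A : Matrix X X ℤ} {B : Matrix Y Y ℤ} (F : Folding A B)

/-- For `j ∈ I` outside the projection of `C`, the whole orbit `σ(j)` lies in `σ(I)` outside the
component, hence is orthogonal to it. So the projection splits off orthogonally from the connected
`I` and must be all of it. -/
theorem proj_image_component (hB : IsFiniteSymmetric B) (hA : ∀ i, A i i = 2) {I : ConnSub A}
    {C : ConnSub B} (hC : C ∈ components B (F.image I.1)) : F.proj '' C.1 = I.1 := by
  have hCI : F.proj '' C.1 ⊆ I.1 := by
    rintro _ ⟨y, hy, rfl⟩
    exact F.mem_image.1 (subset_of_mem_components hC hy)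
  refine (((F.isRootDatum hB hA).isConn_iff).1 I.2).2 _ hCI (C.nonempty.image _) ?_
  rintro _ ⟨y, hy, rfl⟩ j ⟨hj, hjC⟩
  refine (F.cartan_proj y j).trans (Finset.sum_eq_zero fun z hz => ?_)
  rw [F.mem_fibre] at hz
  refine hB.isRootDatum.orth_component hC y hy z ⟨F.mem_image.2 (by rwa [hz]), fun hzC => hjC ?_⟩
  exact ⟨z, hzC, hz⟩

/-- The reduced word of parabolics in `Y` which belongs to a word in the generators of `J_X`. -/
def unfold (hB : IsFiniteSymmetric B) : List (ConnSub A) → List (Set (Y → ℤ))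
  | [] => []
  | K :: l => ((components B (F.image K.1)).toList.map fun C => coordSpan C.1) ++
      (unfold hB l).map (hB.isRootDatum.letterPerm (F.image K.1)).1

/-- If a component of `σ(I)` cancels against a letter of an unfolded word, then `s_I` cancels
against a letter of the word. -/
theorem exists_shorter (hB : IsFiniteSymmetric B) (hA : ∀ i, A i i = 2) (l : List (ConnSub A))
    (I : ConnSub A) (C : ConnSub B) (hC : C ∈ components B (F.image I.1))
    (hcan : Cancels (NestedOrOrth B 1) (coordSpan C.1) (F.unfold hB l)) :
    ∃ l' : List (ConnSub A), l'.length + 1 = l.length ∧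
      gen I * (l.map gen).prod = (l'.map gen).prod := by
  have hX := F.isRootDatum hB hA
  have hY := hB.isRootDatum
  -- Passing `s_K` may replace `I` by `θ_K(I)` and `C` by a component of its unfolding, so both vary
  -- in the induction.
  induction l generalizing I C with
  | nil => exact hcan.elim
  | cons K l ih =>
    have hpre : ∀ P, (hY.letterPerm (F.image K.1)).1 P = coordSpan C.1 →
        Cancels (NestedOrOrth B 1) (coordSpan C.1)
          ((F.unfold hB l).map (hY.letterPerm (F.image K.1)).1) →
        Cancels (NestedOrOrth B 1) P (F.unfold hB l) := fun P hP h => by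
      rw [← hP] at h
      exact (cancels_map_iff _ (hY.letterPerm (F.image K.1)).2 _ _).1 h
    rcases hcan.of_append with hmem | ⟨hcomm, hcan'⟩
    -- The letter meets an equal one among the components of `σ(K)`; both components project onto
    -- their diagrams, so `I = K` and `s_I s_K = 1`.
    · obtain ⟨D, hD, hDC⟩ := List.mem_map.1 hmem
      have hDC' : D = C := Subtype.ext (coordSpan_injective hDC)
      have hIK : I = K := Subtype.ext (by
        rw [← F.proj_image_component hB hA hC, ← hDC',
          F.proj_image_component hB hA (Finset.mem_toList.1 hD)])
      refine ⟨l, rfl, ?_⟩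
      rw [hIK, List.map_cons, List.prod_cons, ← mul_assoc, gen_mul_self, one_mul]
    have hcases : ∀ D ∈ components B (F.image K.1),
        C.1 ⊆ D.1 ∨ D.1 ⊆ C.1 ∨ Orth B C.1 D.1 := fun D hD =>
      hY.nestedOrOrth_coordSpan.1 (hcomm _ (List.mem_map.2 ⟨D, Finset.mem_toList.2 hD, rfl⟩))
    -- A single component inside `C` already forces `K ⊆ I`. Then the longest element of `σ(K)`
    -- stabilizes the span of `C`, and `s_I s_K = s_{θ_I(K)} s_I`.
    by_cases h1 : ∃ D ∈ components B (F.image K.1), D.1 ⊆ C.1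
    · obtain ⟨D, hD, hDC⟩ := h1
      have hKI : K.1 ⊆ I.1 := by
        rw [← F.proj_image_component hB hA hC, ← F.proj_image_component hB hA hD]
        exact Set.image_mono hDC
      have hfix := hY.letterPerm_coordSpan_of_subset (hY.orth_component hC) (F.image_mono hKI)
      obtain ⟨l', hlen, hl'⟩ := ih I C hC (hpre _ hfix hcan')
      refine ⟨hX.oppSub I.1 K hKI :: l', by simp [hlen], ?_⟩
      rw [List.map_cons, List.prod_cons, ← mul_assoc, hX.gen_mul_gen hKI, mul_assoc, hl',
        List.map_cons, List.prod_cons]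
    -- Here `I ⊆ K`. Undoing the longest element of `σ(K)` turns `C` into a component of
    -- `σ(θ_K(I))`, matching `s_I s_K = s_K s_{θ_K(I)}`.
    by_cases h2 : ∃ D ∈ components B (F.image K.1), C.1 ⊆ D.1
    · obtain ⟨D, hD, hCD⟩ := h2
      have hIK : I.1 ⊆ K.1 := by
        rw [← F.proj_image_component hB hA hC, ← F.proj_image_component hB hA hD]
        exact Set.image_mono hCD
      have hCK : C.1 ⊆ F.image K.1 := (subset_of_mem_components hC).trans (F.image_mono hIK)
      have hC' := hY.oppSub_mem_components (F.image_mono hIK) hC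
      rw [F.opp_image hB hA hIK] at hC'
      have hmap : (hY.letterPerm (F.image K.1)).1
          (coordSpan (hY.oppSub (F.image K.1) C hCK).1) = coordSpan C.1 :=
        (hY.letterPerm_coordSpan (hY.opp_image_subset hCK)).trans
          (by rw [hY.opp_image_opp_image hCK])
      obtain ⟨l', hlen, hl'⟩ := ih (hX.oppSub K.1 I hIK) _ hC' (hpre _ hmap hcan')
      have hgen : gen K * gen (hX.oppSub K.1 I hIK) = gen I * gen K := by
        rw [hX.gen_mul_gen (hX.opp_image_subset hIK)]
        congr 2
        exact Subtype.ext (hX.opp_image_opp_image hIK)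
      refine ⟨K :: l', by simp [hlen], ?_⟩
      rw [List.map_cons, List.prod_cons, ← mul_assoc, ← hgen, mul_assoc, hl', List.map_cons,
        List.prod_cons]
    -- With no inclusion, `C` is orthogonal to every component of `σ(K)`, so `I` and `K` are
    -- orthogonal and the generators commute.
    · have hO : Orth B C.1 (F.image K.1) := by
        intro y hy z hz
        obtain ⟨D, hD, hzD⟩ := hY.exists_mem_component hz
        rcases hcases D hD with h | h | h
        · exact (h2 ⟨D, hD, h⟩).elim
        · exact (h1 ⟨D, hD, h⟩).elim
        · exact h y hy z hzD
      have hIK : Orth A I.1 K.1 := by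
        intro i hi k hk
        rw [← F.proj_image_component hB hA hC] at hi
        obtain ⟨y, hy, rfl⟩ := hi
        refine (F.cartan_proj y k).trans (Finset.sum_eq_zero fun z hz => hO y hy z ?_)
        rw [F.mem_image, F.mem_fibre.1 hz]
        exact hk
      obtain ⟨l', hlen, hl'⟩ := ih I C hC (hpre _ (hY.letterPerm_coordSpan_of_orth hO) hcan')
      refine ⟨K :: l', by simp [hlen], ?_⟩
      rw [List.map_cons, List.prod_cons, ← mul_assoc, (hX.commute_gen hIK).eq, mul_assoc, hl',
        List.map_cons, List.prod_cons]

/-- Unfolding a shortest word computes the action of the group element. -/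
theorem cactusAction_cactusHom (hB : IsFiniteSymmetric B) (hA : ∀ i, A i i = 2)
    (l : List (ConnSub A))
    (hmin : ∀ l' : List (ConnSub A), (l'.map gen).prod = (l.map gen).prod → l.length ≤ l'.length) :
    ∃ h : Reduced (NestedOrOrth B 1) (F.unfold hB l),
      hB.isRootDatum.cactusAction (F.cactusHom hB hA (l.map gen).prod) (Trace.mk [] reduced_nil) =
        Trace.mk (F.unfold hB l) h := by
  have hY := hB.isRootDatum
  induction l with
  | nil => exact ⟨reduced_nil, by simp only [List.map_nil, List.prod_nil, map_one]; rfl⟩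
  | cons I l ih =>
    -- The tail of a shortest word is again shortest.
    obtain ⟨hr, he⟩ := ih fun l' hl' => by
      have := hmin (I :: l') (by simp [hl'])
      simpa using this
    have hr' : Reduced (NestedOrOrth B 1)
        ((F.unfold hB l).map (hY.letterPerm (F.image I.1)).1) :=
      (reduced_map_iff _ (hY.letterPerm (F.image I.1)).2 _).2 hr
    have hnodup : ((components B (F.image I.1)).toList.map fun C => coordSpan C.1).Nodup :=
      (Finset.nodup_toList _).map fun _ _ h => Subtype.ext (coordSpan_injective h)
    obtain ⟨h, heq⟩ := Trace.prod_actPerm_mk hY.nestedOrOrth_symm hnodup hr' fun P hP hcan => by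
      obtain ⟨C, hC, rfl⟩ := List.mem_map.1 hP
      rw [Finset.mem_toList] at hC
      -- The longest element of `σ(I)` stabilizes the span of its component `C`, so the cancellation
      -- already occurs in the unfolded tail.
      rw [← hY.letterPerm_coordSpan_of_subset (hY.orth_component hC) subset_rfl,
        cancels_map_iff _ (hY.letterPerm (F.image I.1)).2] at hcan
      obtain ⟨l', hlen, hl'⟩ := F.exists_shorter hB hA l I C hC hcan
      have := hmin l' (by rw [List.map_cons, List.prod_cons, hl'])
      simp only [List.length_cons] at this
      omega
    refine ⟨h, ?_⟩
    rw [List.map_cons, List.prod_cons, map_mul, map_mul, Equiv.Perm.mul_apply, he, cactusHom_gen,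
      sTilde_eq_setGen, hY.cactusAction_setGen, Equiv.Perm.mul_apply, Trace.mapPerm_mk]
    exact heq

theorem cactusHom_injective (hB : IsFiniteSymmetric B) (hA : ∀ i, A i i = 2) :
    Function.Injective (F.cactusHom hB hA) := by
  refine (injective_iff_map_eq_one _).2 fun g hg => ?_
  obtain ⟨l, hl, hmin⟩ : ∃ l : List (ConnSub A), (l.map gen).prod = g ∧
      ∀ l' : List (ConnSub A), (l'.map gen).prod = g → l.length ≤ l'.length := by
    classical
    have hex : ∃ n, ∃ l : List (ConnSub A), (l.map gen).prod = g ∧ l.length = n :=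
      (exists_word g).elim fun l hl => ⟨_, l, hl, rfl⟩
    obtain ⟨l, hl, hn⟩ := Nat.find_spec hex
    exact ⟨l, hl, fun l' hl' => hn.le.trans (Nat.find_min' hex ⟨l', hl', rfl⟩)⟩
  obtain ⟨h, he⟩ := F.cactusAction_cactusHom hB hA l (by rwa [hl])
  rw [hl, hg, map_one, Equiv.Perm.one_apply] at he
  have hnil := (Trace.mk_eq_mk.1 he).symm.eq_nil
  rcases l with _ | ⟨I, l⟩
  · exact hl.symm
  -- A nonempty word has a nonempty unfolding, since `σ(I)` has at least one component.
  · have := List.append_eq_nil_iff.1 hnil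
    rw [List.map_eq_nil_iff, Finset.toList_eq_nil] at this
    obtain ⟨i, hi⟩ := I.nonempty
    obtain ⟨y, rfl⟩ := F.proj_surjective i
    obtain ⟨C, hC, -⟩ := hB.isRootDatum.exists_mem_component (F.mem_image.2 hi)
    rw [this.1] at hC
    exact absurd hC (Finset.notMem_empty C)

end Folding

/-! ### Virtual cactus groups -/

namespace Folding

variable {X Y : Type*} [Fintype X] [DecidableEq X] [Fintype Y] [DecidableEq Y]
  {A : Matrix X X ℤ} {B : Matrix Y Y ℤ} (F : Folding A B)

/-- The indices of the generators of `J^v_X` and `J_X` correspond to each other. -/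
def virtualSubEquiv : ConnSub A ≃ F.VirtualSub :=
  Equiv.ofBijective F.virtualSub
    ⟨fun _ _ h => Subtype.ext (F.image_injective (congrArg Subtype.val h)),
      fun ⟨_, I, hI⟩ => ⟨I, Subtype.ext hI⟩⟩

theorem virtualSubEquiv_symm_virtualSub (I : ConnSub A) :
    F.virtualSubEquiv.symm (F.virtualSub I) = I :=
  F.virtualSubEquiv.symm_apply_apply I

/-- The homomorphism `J^v_X → J_X` with `s_{σ(I)} ↦ s_I`. -/
def virtualHom : F.VirtualCactusGroup →* CactusGroup A :=
  PresentedGroup.toGroup (f := fun S => gen (F.virtualSubEquiv.symm S)) (by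
    rintro _ (I | ⟨I, J, hIJ⟩ | ⟨I, J, K, hJ, hK⟩) <;>
      simp only [map_mul, map_inv, FreeGroup.lift_apply_of, virtualSubEquiv_symm_virtualSub]
    · exact PresentedGroup.one_of_mem (CactusRel.sq I)
    · exact PresentedGroup.one_of_mem (CactusRel.comm I J hIJ)
    · exact PresentedGroup.one_of_mem (CactusRel.conj I J K hJ hK))

theorem virtualHom_virtualGen (I : ConnSub A) : F.virtualHom (F.virtualGen I) = gen I :=
  (PresentedGroup.toGroup.of _).trans (congrArg gen (F.virtualSubEquiv_symm_virtualSub I))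

/-- The homomorphism `J_X → J^v_X` with `s_I ↦ s_{σ(I)}`. -/
def virtualInv : CactusGroup A →* F.VirtualCactusGroup :=
  PresentedGroup.toGroup (f := F.virtualGen) (by
    rintro _ (I | ⟨I, J, hIJ⟩ | ⟨I, J, K, hJ, hK⟩) <;>
      simp only [map_mul, map_inv, FreeGroup.lift_apply_of]
    · exact PresentedGroup.one_of_mem (VirtualRel.sq I)
    · exact PresentedGroup.one_of_mem (VirtualRel.comm I J hIJ)
    · exact PresentedGroup.one_of_mem (VirtualRel.conj I J K hJ hK))

theorem virtualInv_gen (I : ConnSub A) : F.virtualInv (gen I) = F.virtualGen I :=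
  PresentedGroup.toGroup.of _

/-- The isomorphism `J^v_X ≅ J_X`. -/
def virtualEquiv : F.VirtualCactusGroup ≃* CactusGroup A :=
  MonoidHom.toMulEquiv F.virtualHom F.virtualInv
    (PresentedGroup.ext fun S => by
      obtain ⟨I, rfl⟩ := F.virtualSubEquiv.surjective S
      exact (congrArg F.virtualInv (F.virtualHom_virtualGen I)).trans (F.virtualInv_gen I))
    (PresentedGroup.ext fun I =>
      (congrArg F.virtualHom (F.virtualInv_gen I)).trans (F.virtualHom_virtualGen I))

theorem virtualEquiv_virtualGen (I : ConnSub A) : F.virtualEquiv (F.virtualGen I) = gen I :=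
  F.virtualHom_virtualGen I

/-- The embedding of cactus groups and the virtual cactus group of a folding of finite type. -/
theorem exists_cactus_embedding (hB : IsFiniteSymmetric B) (hA : ∀ i, A i i = 2) :
    ∃ Φ : CactusGroup A →* CactusGroup B,
      (∀ I : ConnSub A, Φ (gen I) = F.sTilde I) ∧
      Function.Injective Φ ∧
      (∃ e : F.VirtualCactusGroup ≃* Φ.range,
        ∀ I : ConnSub A, (e (F.virtualGen I) : CactusGroup B) = F.sTilde I) ∧
      (∃ e : F.VirtualCactusGroup ≃* CactusGroup A,
        ∀ I : ConnSub A, e (F.virtualGen I) = gen I) := by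
  refine ⟨F.cactusHom hB hA, F.cactusHom_gen hB hA, F.cactusHom_injective hB hA,
    ⟨F.virtualEquiv.trans (MonoidHom.ofInjective (F.cactusHom_injective hB hA)), fun I => ?_⟩,
    F.virtualEquiv, F.virtualEquiv_virtualGen⟩
  rw [MulEquiv.trans_apply, virtualEquiv_virtualGen]
  exact F.cactusHom_gen hB hA I

end Folding

/-! ### Positive definiteness of the matrices of type A, D, E -/

section PosDef

variable {κ : Type*} [Fintype κ] [DecidableEq κ] {B : Matrix κ κ ℤ}

/-- A connected symmetric matrix with a positive vector `x` such that `B x` is nonnegative and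
nonzero is positive definite. -/
theorem IsFiniteSymmetric.of_positive_vector (diag : ∀ y, B y y = 2)
    (symm : ∀ y z, B y z = B z y) (nonpos : ∀ y z, y ≠ z → B y z ≤ 0) (x : κ → ℤ)
    (hx : ∀ i, 0 < x i) (hBx : ∀ i, 0 ≤ ∑ j, B i j * x j) (o : κ) (ho : 0 < ∑ j, B o j * x j)
    (hconn : ∀ P : κ → Prop, P o → (∀ i j, P i → B i j ≠ 0 → P j) → ∀ i, P i) :
    IsFiniteSymmetric B where
  diag := diag
  symm := symm
  nonpos := nonpos
  pos v hv := by
    by_contra hle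
    refine hv (funext fun i => ?_)
    -- With `vᵢ = xᵢ aᵢ`, twice the norm is `∑ -Bᵢⱼ xᵢ xⱼ (aᵢ - aⱼ)² + 2 ∑ xᵢ aᵢ² (B x)ᵢ`, and all
    -- terms are nonnegative. If the norm is not positive they all vanish, so `a` is zero at `o` and
    -- constant along edges.
    let a : κ → ℚ := fun i => v i / x i
    have hxq : ∀ i, (0 : ℚ) < x i := fun i => Int.cast_pos.2 (hx i)
    have hav : ∀ i, (v i : ℚ) = x i * a i := fun i => (mul_div_cancel₀ _ (hxq i).ne').symm
    have hT : ∀ i j, 0 ≤ -(B i j * x i * x j : ℚ) * (a i - a j) ^ 2 := by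
      intro i j
      by_cases hij : i = j
      · simp [hij]
      · have hBq : (B i j : ℚ) ≤ 0 := Int.cast_nonpos.2 (nonpos i j hij)
        refine mul_nonneg (neg_nonneg.2 ?_) (sq_nonneg _)
        exact mul_nonpos_of_nonpos_of_nonneg
          (mul_nonpos_of_nonpos_of_nonneg hBq (hxq i).le) (hxq j).le
    have hS : ∀ i, 0 ≤ (x i * a i ^ 2) * ((∑ j, B i j * x j : ℤ) : ℚ) := fun i =>
      mul_nonneg (mul_nonneg (hxq i).le (sq_nonneg _)) (Int.cast_nonneg (hBx i))
    have hform : ((form B 1 v v : ℤ) : ℚ) = ∑ i, ∑ j, B i j * (v i * v j : ℚ) := by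
      rw [form_apply, Finset.sum_comm]
      push_cast
      refine Finset.sum_congr rfl fun j _ => ?_
      rw [simpleCoroot_apply]
      push_cast
      rw [Pi.one_apply, Int.cast_one, one_mul, Finset.sum_mul]
      exact Finset.sum_congr rfl fun i _ => by ring
    have hswap : ∑ i, ∑ j, (B i j * x i * x j : ℚ) * a j ^ 2 =
        ∑ i, ∑ j, (B i j * x i * x j : ℚ) * a i ^ 2 := by
      rw [Finset.sum_comm]
      refine Finset.sum_congr rfl fun i _ => Finset.sum_congr rfl fun j _ => ?_
      rw [symm j i]
      ring
    have hsum : ∑ i, ∑ j, -(B i j * x i * x j : ℚ) * (a i - a j) ^ 2 +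
        2 * ∑ i, (x i * a i ^ 2) * ((∑ j, B i j * x j : ℤ) : ℚ) = 2 * (form B 1 v v : ℤ) := by
      have h1 : ∑ i, (x i * a i ^ 2) * ((∑ j, B i j * x j : ℤ) : ℚ) =
          ∑ i, ∑ j, (B i j * x i * x j : ℚ) * a i ^ 2 := by
        refine Finset.sum_congr rfl fun i _ => ?_
        push_cast
        rw [Finset.mul_sum]
        exact Finset.sum_congr rfl fun j _ => by ring
      rw [hform, h1, two_mul (∑ i, ∑ j, (B i j * x i * x j : ℚ) * a i ^ 2)]
      nth_rewrite 2 [← hswap]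
      simp only [Finset.mul_sum, ← Finset.sum_add_distrib]
      refine Finset.sum_congr rfl fun i _ => Finset.sum_congr rfl fun j _ => ?_
      rw [hav i, hav j]
      ring
    have hleq : ((form B 1 v v : ℤ) : ℚ) ≤ 0 := Int.cast_nonpos.2 (not_lt.1 hle)
    have hT0 := Finset.sum_nonneg fun i (_ : i ∈ Finset.univ) =>
      Finset.sum_nonneg fun j (_ : j ∈ Finset.univ) => hT i j
    have hS0 := Finset.sum_nonneg fun i (_ : i ∈ Finset.univ) => hS i
    have hTz := (Finset.sum_eq_zero_iff_of_nonneg fun i _ =>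
      Finset.sum_nonneg fun j (_ : j ∈ Finset.univ) => hT i j).1 (le_antisymm (by linarith) hT0)
    have hSz := (Finset.sum_eq_zero_iff_of_nonneg fun i _ => hS i).1
      (le_antisymm (by linarith) hS0)
    have hao : a o = 0 := by
      have := hSz o (Finset.mem_univ o)
      have h2 : ((∑ j, B o j * x j : ℤ) : ℚ) ≠ 0 := Int.cast_ne_zero.2 ho.ne'
      exact (pow_eq_zero_iff two_ne_zero).1
        ((mul_eq_zero.1 ((mul_eq_zero.1 this).resolve_right h2)).resolve_left (hxq o).ne')
    have hai := hconn (fun i => a i = 0) hao (fun i j hi hij => by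
      have h1 := (Finset.sum_eq_zero_iff_of_nonneg fun j _ => hT i j).1 (hTz i (Finset.mem_univ i))
        j (Finset.mem_univ j)
      have h2 : -(B i j * x i * x j : ℚ) ≠ 0 := neg_ne_zero.2
        (mul_ne_zero (mul_ne_zero (Int.cast_ne_zero.2 hij) (hxq i).ne') (hxq j).ne')
      have h3 := (pow_eq_zero_iff two_ne_zero).1 ((mul_eq_zero.1 h1).resolve_left h2)
      rw [hi] at h3
      linarith) i
    have := hav i
    rw [hai, mul_zero] at this
    exact_mod_cast this

theorem sum_ite_le_one (P : κ → Prop) [DecidablePred P] (hP : ∀ a b, P a → P b → a = b) :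
    ∑ a, (if P a then 1 else 0 : ℤ) ≤ 1 := by
  rw [Finset.sum_boole]
  exact_mod_cast Finset.card_le_one.2 fun a ha b hb =>
    hP a b (Finset.mem_filter.1 ha).2 (Finset.mem_filter.1 hb).2

/-- The all-ones vector serves: row sums are `2` minus the number of neighbours, and the end node
`0` has at most one. -/
theorem isFiniteSymmetric_A {n : ℕ} (hn : 0 < n) : IsFiniteSymmetric (CartanMatrix.A n) := by
  have hsum : ∀ i : Fin n, ∑ j, CartanMatrix.A n i j * 1 =
      2 - ∑ j : Fin n, (if (i : ℕ) + 1 = j then 1 else 0) -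
        ∑ j : Fin n, (if (j : ℕ) + 1 = i then 1 else 0) := by
    intro i
    have h2 : (2 : ℤ) = ∑ j : Fin n, if i = j then 2 else 0 := by simp
    rw [h2, ← Finset.sum_sub_distrib, ← Finset.sum_sub_distrib]
    refine Finset.sum_congr rfl fun j _ => ?_
    simp only [CartanMatrix.A, Matrix.of_apply, Fin.ext_iff]
    split_ifs <;> omega
  have hle : ∀ i : Fin n, ∑ j : Fin n, (if (i : ℕ) + 1 = j then 1 else 0 : ℤ) ≤ 1 := fun i =>
    sum_ite_le_one _ fun a b ha hb => Fin.ext (by omega)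
  have hle' : ∀ i : Fin n, ∑ j : Fin n, (if (j : ℕ) + 1 = i then 1 else 0 : ℤ) ≤ 1 := fun i =>
    sum_ite_le_one _ fun a b ha hb => Fin.ext (by omega)
  refine IsFiniteSymmetric.of_positive_vector (fun y => congrFun (CartanMatrix.A_diag n) y)
    (fun y z => (CartanMatrix.A_isSymm n).apply z y) (CartanMatrix.A_apply_le_zero_of_ne n)
    (fun _ => 1) (fun _ => one_pos) (fun i => ?_) ⟨0, hn⟩ ?_ ?_
  · rw [hsum]
    linarith [hle i, hle' i]
  · rw [hsum]
    have := hle ⟨0, hn⟩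
    simp only [Nat.add_eq_zero_iff, one_ne_zero, and_false, if_false, Finset.sum_const_zero]
    linarith
  · rintro P h0 hP ⟨i, hi⟩
    induction i with
    | zero => exact h0
    | succ i ih =>
      refine hP ⟨i, by omega⟩ _ (ih _) ?_
      simp [CartanMatrix.A]

theorem isFiniteSymmetric_D {n : ℕ} (hn : 2 ≤ n) :
    IsFiniteSymmetric (CartanMatrix.D (n + 1)) := by
  -- This is twice the first fundamental weight: `2` along the chain, `1` on the last two nodes.
  let x : Fin (n + 1) → ℤ := fun z => if (z : ℕ) < n - 1 then 2 else 1
  -- The last two indicator sums together count right neighbours with weight `x`: one on the chain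
  -- occurs in both, while the two end nodes occur once each.
  have hsum : ∀ i : Fin (n + 1), (i : ℕ) < n - 1 → ∑ j, CartanMatrix.D (n + 1) i j * x j =
      4 - 2 * ∑ j : Fin (n + 1), (if (j : ℕ) + 1 = i then 1 else 0) -
        ∑ j : Fin (n + 1), (if (i : ℕ) + 1 = j then 1 else 0) -
        ∑ j : Fin (n + 1), (if ((j : ℕ) < n - 1 ∧ (i : ℕ) + 1 = j) ∨ ((i : ℕ) + 2 = n ∧ (j : ℕ) = n)
          then 1 else 0) := by
    intro i hi
    have h2 : (4 : ℤ) = ∑ j : Fin (n + 1), if i = j then 4 else 0 := by simp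
    rw [h2, Finset.mul_sum, ← Finset.sum_sub_distrib, ← Finset.sum_sub_distrib,
      ← Finset.sum_sub_distrib]
    refine Finset.sum_congr rfl fun j _ => ?_
    have hj := j.isLt
    by_cases hjn : (j : ℕ) < n - 1
    · rw [Folding.D_apply_of_lt n i j hjn]
      simp only [x, Fin.ext_iff, hjn, if_true, true_and]
      split_ifs <;> omega
    · rw [Folding.D_apply_of_le n hn i j (not_lt.1 hjn)]
      simp only [x, Fin.ext_iff, hjn, if_false, false_and, false_or]
      split_ifs <;> omega
  have hsum' : ∀ i : Fin (n + 1), ¬ (i : ℕ) < n - 1 → ∑ j, CartanMatrix.D (n + 1) i j * x j =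
      (∑ j : Fin (n + 1), if i = j then 2 else 0) -
        2 * ∑ j : Fin (n + 1), (if (j : ℕ) + 2 = n then 1 else 0) := by
    intro i hi
    rw [Finset.mul_sum, ← Finset.sum_sub_distrib]
    refine Finset.sum_congr rfl fun j _ => ?_
    have hj := j.isLt
    have hi' := i.isLt
    by_cases hjn : (j : ℕ) < n - 1
    · rw [Folding.D_apply_of_lt n i j hjn]
      simp only [x, Fin.ext_iff, hjn, if_true]
      split_ifs <;> omega
    · rw [Folding.D_apply_of_le n hn i j (not_lt.1 hjn)]
      simp only [x, Fin.ext_iff, hjn, if_false]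
      split_ifs <;> omega
  have hle1 : ∀ i : Fin (n + 1), ∑ j : Fin (n + 1), (if (j : ℕ) + 1 = i then 1 else 0 : ℤ) ≤ 1 :=
    fun i => sum_ite_le_one _ fun a b ha hb => Fin.ext (by omega)
  have hle2 : ∀ i : Fin (n + 1), ∑ j : Fin (n + 1), (if (i : ℕ) + 1 = j then 1 else 0 : ℤ) ≤ 1 :=
    fun i => sum_ite_le_one _ fun a b ha hb => Fin.ext (by omega)
  have hle3 : ∀ i : Fin (n + 1), ∑ j : Fin (n + 1), (if ((j : ℕ) < n - 1 ∧ (i : ℕ) + 1 = j) ∨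
      ((i : ℕ) + 2 = n ∧ (j : ℕ) = n) then 1 else 0 : ℤ) ≤ 1 :=
    fun i => sum_ite_le_one _ fun a b ha hb => Fin.ext (by omega)
  have hle4 : ∑ j : Fin (n + 1), (if (j : ℕ) + 2 = n then 1 else 0 : ℤ) ≤ 1 :=
    sum_ite_le_one _ fun a b ha hb => Fin.ext (by omega)
  refine IsFiniteSymmetric.of_positive_vector (CartanMatrix.D_diag _)
    (fun y z => (CartanMatrix.D_isSymm _).apply z y) (CartanMatrix.D_off_diag_nonpos _)
    x (fun z => by simp only [x]; split_ifs <;> norm_num) (fun i => ?_) 0 ?_ ?_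
  · by_cases hi : (i : ℕ) < n - 1
    · rw [hsum i hi]
      linarith [hle1 i, hle2 i, hle3 i]
    · rw [hsum' i hi, Finset.sum_ite_eq, if_pos (Finset.mem_univ i)]
      linarith
  · rw [hsum 0 (by simp; omega)]
    have h1 := hle2 0
    have h2 := hle3 0
    have h3 : ∑ j : Fin (n + 1), (if (j : ℕ) + 1 = ((0 : Fin (n + 1)) : ℕ) then 1 else 0 : ℤ) = 0 :=
      Finset.sum_eq_zero fun j _ => if_neg (by simp)
    rw [h3]
    linarith
  · intro P h0 hP
    have hlt : ∀ i (hi : i < n), P ⟨i, by omega⟩ := by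
      intro i hi
      induction i with
      | zero => exact h0
      | succ i ih =>
        refine hP ⟨i, by omega⟩ _ (ih (by omega)) ?_
        by_cases hin : i + 1 < n - 1
        · rw [Folding.D_apply_of_lt n _ _ hin]
          simp
        · rw [Folding.D_apply_of_le n hn _ _ (not_lt.1 hin), if_neg (by simp), if_pos (by simp; omega)]
          norm_num
    intro i
    by_cases hi : (i : ℕ) < n
    · exact hlt i hi
    · refine hP ⟨n - 2, by omega⟩ i (hlt _ (by omega)) ?_
      rw [Folding.D_apply_of_le n hn _ _ (by omega), if_neg (by simp; omega),
        if_pos (by simp; omega)]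
      norm_num

theorem isFiniteSymmetric_E₆ : IsFiniteSymmetric CartanMatrix.E₆ := by
  refine IsFiniteSymmetric.of_positive_vector CartanMatrix.E₆_diag
    (fun y z => CartanMatrix.E₆_isSymm.apply z y) CartanMatrix.E₆_off_diag_nonpos
    -- These are the coefficients of the highest root, which pairs to zero with every simple coroot
    -- except that of node `1`.
    ![1, 2, 2, 3, 2, 1] (by decide) (by decide) 1 (by decide) fun P h1 hP => ?_
  have h3 : P 3 := hP 1 3 h1 (by decide)
  have h2 : P 2 := hP 3 2 h3 (by decide)
  have h4 : P 4 := hP 3 4 h3 (by decide)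
  have h0 : P 0 := hP 2 0 h2 (by decide)
  have h5 : P 5 := hP 4 5 h4 (by decide)
  intro i
  fin_cases i <;> assumption

end PosDef

end Dynkin

end

/-! ### The listed foldings. -/

theorem mainTheorem1 {m k : ℕ} {A : Matrix (Fin m) (Fin m) ℤ} {B : Matrix (Fin k) (Fin k) ℤ}
    (F : Dynkin.Folding A B) (hF : F.IsStandard) :
    ∃ Φ : Dynkin.CactusGroup A →* Dynkin.CactusGroup B,
      (∀ I : Dynkin.ConnSub A, Φ (Dynkin.gen I) = F.sTilde I) ∧
      Function.Injective Φ ∧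
      (∃ e : F.VirtualCactusGroup ≃* Φ.range,
        ∀ I : Dynkin.ConnSub A, (e (F.virtualGen I) : Dynkin.CactusGroup B) = F.sTilde I) ∧
      (∃ e : F.VirtualCactusGroup ≃* Dynkin.CactusGroup A,
        ∀ I : Dynkin.ConnSub A, e (F.virtualGen I) = Dynkin.gen I) := by
  cases hF with
  | C n hn =>
    exact Dynkin.Folding.exists_cactus_embedding _ (Dynkin.isFiniteSymmetric_A (by omega))
      (CartanMatrix.C_diag _)
  | B n hn =>
    exact Dynkin.Folding.exists_cactus_embedding _ (Dynkin.isFiniteSymmetric_D hn)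
      (CartanMatrix.B_diag _)
  | G =>
    -- The diagonal of the transpose of `G₂` is definitionally that of `G₂`.
    exact Dynkin.Folding.exists_cactus_embedding _
      (Dynkin.isFiniteSymmetric_D (n := 3) (by norm_num)) CartanMatrix.G₂_diag
  | F =>
    exact Dynkin.Folding.exists_cactus_embedding _ Dynkin.isFiniteSymmetric_E₆
      CartanMatrix.F₄_diag
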